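/- **Setting.** Let $N\ge 2$, $m\ge 1$, and let $r_0=r_N=1$, $r_1,\dots,r_{N-1}\ge 1$ be integers, $\overline r=\max_{1\le i\le N-1} r_i$. For factors $X_i\in\mathbb R^{r_{i-1}\times d_i\times r_i}$ with slices $X_i(s)=X_i(:,s,:)\in\mathbb R^{r_{i-1}\times r_i}$, let $[X_1,\dots,X_N]\in\mathbb R^{d_1\times\cdots\times d_N}$ be the tensor with entries $X_1(s_1)X_2(s_2)\cdots X_N(s_N)$ (a tensor in TT format with ranks $(r_1,\dots,r_{N-1})$), and let $L(X_i)\in\mathbb R^{d_ir_{i-1}\times r_i}$ be the left unfolding, obtained by stacking the slices $X_i(1),\dots,X_i(d_i)$. The factors are left-orthogonal if $L(X_i)^\top L(X_i)=I_{r_i}$ for $1\le i\le N-1$. Let $\mathcal X^{\langle i\rangle}$ denote the $(d_1\cdots d_i)\times(d_{i+1}\cdots d_N)$ unfolding matrix of a tensor $\mathcal X$. Let $\mathcal X^\star=[X_1^\star,\dots,X_N^\star]$ with left-orthogonal factors and TT ranks $(r_1,\dots,r_{N-1})$, that is, $\operatorname{rank}(\mathcal X^{\star\langle i\rangle})=r_i$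 for $1\le i\le N-1$. Put $\overline\sigma=\max_{1\le i\le N-1}\sigma_1(\mathcal X^{\star\langle i\rangle})$, $\underline\sigma=\min_{1\le i\le N-1}\sigma_{r_i}(\mathcal X^{\star\langle i\rangle})$, $\kappa=\overline\sigma/\underline\sigma$ and $S=N+1+\sum_{i=2}^{N-1}r_i$. Let $\mathcal A_1,\dots,\mathcal A_m\in\mathbb R^{d_1\times\cdots\times d_N}$, $\mathcal A(\mathcal X)=(\langle\mathcal A_k,\mathcal X\rangle)_{k=1}^m$, let $s\in\mathbb R^m$ be an outlier vector, $p_s=\|s\|_0/m$, and $y=\mathcal A(\mathcal X^\star)+s$. Define $$F(X_1,\dots,X_N)=\tfrac1m\|\mathcal A([X_1,\dots,X_N])-y\|_1 ,$$ and let $\partial_{L(X_i)}F$ be its subgradient with respect to $L(X_i)$ obtained from the subgradient $\frac1m\sum_k\operatorname{sign}(\langle\mathcal A_k,\mathcal X\rangle-y_k)\mathcal A_k$ at $\mathcal X=[X_1,\dots,X_N]$ by the chain rule, with $\operatorname{sign}(0)=0$; that is, its block with index $s_i$ is $$\frac1m\sum_{k=1}^m\operatorname{sign}(\langle\mathcal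 A_k,\mathcal X\rangle-y_k)\sum_{s_1,\dots,s_{i-1},s_{i+1},\dots,s_N}\mathcal A_k(s_1,\dots,s_N)\,X_{i-1}^\top(s_{i-1})\cdots X_1^\top(s_1)\,X_N^\top(s_N)\cdots X_{i+1}^\top(s_{i+1}).$$ The squared distance between two families of factors is $$\operatorname{dist}^2(\{X_i\},\{X_i^\star\})=\min_{R_i\in\mathbb O^{r_i\times r_i},\,1\le i\le N-1}\ \sum_{i=1}^{N-1}\overline\sigma^2\|L(X_i)-L_R(X_i^\star)\|_F^2+\|L(X_N)-L_R(X_N^\star)\|_2^2,$$ where $L_R(X_i^\star)$ is the left unfolding of the factor with slices $R_{i-1}^\top X_i^\star(s)R_i$, and $R_0=R_N=1$. **Hypotheses.** Let $\delta=\delta_{(N+1)\overline r}$ be a constant with $\delta\le(1-2p_s)\sqrt{2/\pi}$ such that * ($\ell_1/\ell_2$-RIP) $(\sqrt{2/\pi}-\delta)\|\mathcal X\|_F\le\frac1m\|\mathcal A(\mathcal X)\|_1\le(\sqrt{2/\pi}+\delta)\|\mathcal X\|_F$ for all tensors $\mathcal X$ in TT format with all ranks at most $(N+1)\overline r$; *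 (sharpness) $\frac1m\|\mathcal A(\mathcal X-\mathcal X^\star)-s\|_1-\frac1m\|s\|_1\ge((1-2p_s)\sqrt{2/\pi}-\delta)\|\mathcal X-\mathcal X^\star\|_F$ for all tensors $\mathcal X$ in TT format with ranks $(r_1,\dots,r_{N-1})$. Let $\{X_i^{(0)}\}$ be left-orthogonal factors (of the same ranks) of a tensor $\mathcal X^{(0)}$ with $$\|\mathcal X^{(0)}-\mathcal X^\star\|_F^2\le b:=\frac{\underline\sigma^4\big((1-2p_s)\sqrt{2/\pi}-\delta\big)^2}{144(2N^2-2N+1)S^2(\sqrt{2/\pi}+\delta)^2\,\overline\sigma^2}.$$ Run the factorized Riemannian subgradient method $$L(X_i^{(t+1)})=\operatorname{Retr}\Big(L(X_i^{(t)})-\tfrac{\mu_t}{\overline\sigma^2}\mathcal P_{L(X_i^{(t)})}\big(\partial_{L(X_i)}F(X_1^{(t)},\dots,X_N^{(t)})\big)\Big),\quad 1\le i\le N-1,$$ $$L(X_N^{(t+1)})=L(X_N^{(t)})-\mu_t\,\partial_{L(X_N)}F(X_1^{(t)},\dots,X_N^{(t)}),$$ where $\mathcal P_L(U)=U-\frac12L(U^\top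 L+L^\top U)$ is the projection onto the tangent space of the Stiefel manifold at $L$ and $\operatorname{Retr}(G)=G(G^\top G)^{-1/2}$ is the polar retraction, with step sizes $\mu_t=\lambda q^t$, $$\lambda=\frac{(1-2p_s)\sqrt{2/\pi}-\delta}{\sqrt{2S}\,(9N-5)(\sqrt{2/\pi}+\delta)^2\kappa}\operatorname{dist}(\{X_i^{(0)}\},\{X_i^\star\}),\qquad q=\sqrt{1-\frac{\big((1-2p_s)\sqrt{2/\pi}-\delta\big)^2}{8S(9N-5)(\sqrt{2/\pi}+\delta)^2\kappa^2}}.$$ **Theorem** (local linear convergence of FRSubGM). For all $t\ge 0$, $$\operatorname{dist}^2(\{X_i^{(t)}\},\{X_i^\star\})\le q^{2t}\operatorname{dist}^2(\{X_i^{(0)}\},\{X_i^\star\}).$$ -/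

import Mathlib

open scoped Matrix

noncomputable section

namespace RobustTT

/-- Real tensors of order `N` with mode sizes `d 0, …, d (N-1)`. -/
abbrev Tensor {N : ℕ} (d : Fin N → ℕ) : Type := ((i : Fin N) → Fin (d i)) → ℝ

/-- The inner product `⟨A, B⟩ = ∑ A(s₁,…,s_N) B(s₁,…,s_N)`. -/
def tinner {N : ℕ} {d : Fin N → ℕ} (A B : Tensor d) : ℝ := ∑ s, A s * B s

/-- The Frobenius norm of a tensor. -/
def tnorm {N : ℕ} {d : Fin N → ℕ} (X : Tensor d) : ℝ := √(tinner X X)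

/-- The squared Frobenius norm of a matrix. -/
def frobSq {m n : Type*} [Fintype m] [Fintype n] (M : Matrix m n ℝ) : ℝ := ∑ a, ∑ b, M a b ^ 2

/-- Bond dimensions `(r₀, r₁, …, r_N)` of a tensor train, positive, with `r₀ = r_N = 1`. -/
structure TTRanks (N : ℕ) where
  toFun : Fin (N + 1) → ℕ
  pos : ∀ k, 0 < toFun k
  first : toFun 0 = 1
  last : toFun (Fin.last N) = 1

instance (N : ℕ) : CoeFun (TTRanks N) (fun _ => Fin (N + 1) → ℕ) := ⟨TTRanks.toFun⟩

/-- The indices of all factors but the last one (`1, …, N-1` in one-based counting).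
To such an index `i` belong the bond dimension `r i.succ` to the right of the `i`-th factor and the
unfolding that separates the modes up to `i` from the modes after `i`. -/
abbrev InnerIdx (N : ℕ) : Type := {i : Fin N // i.val + 1 < N}

/-- The largest inner rank, `r̄ = max_{1 ≤ i ≤ N-1} r_i`. -/
def TTRanks.max {N : ℕ} (r : TTRanks N) : ℕ :=
  Finset.univ.sup fun i : InnerIdx N => r i.1.succ

/-- Tensor train factors: `X i s` is the slice `X_i(s) = X_i(:, s, :)`, an `r_{i-1} × r_i` matrix. -/
abbrev TTFactors {N : ℕ} (d : Fin N → ℕ) (r : TTRanks N) : Type :=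
  (i : Fin N) → Fin (d i) → Matrix (Fin (r i.castSucc)) (Fin (r i.succ)) ℝ

/-- The product `X_1(s_1) ⋯ X_k(s_k)` of the slices of the first `k` factors. -/
def ttPrefix {N : ℕ} {d : Fin N → ℕ} {r : TTRanks N} (X : TTFactors d r)
    (s : (i : Fin N) → Fin (d i)) : (k : Fin (N + 1)) → Matrix (Fin (r 0)) (Fin (r k)) ℝ :=
  Fin.induction (motive := fun k => Matrix (Fin (r 0)) (Fin (r k)) ℝ) 1
    (fun i P => P * X i (s i))

/-- The product `X_{k+1}(s_{k+1}) ⋯ X_N(s_N)` of the slices of all factors after the `k`-th one. -/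
def ttSuffix {N : ℕ} {d : Fin N → ℕ} {r : TTRanks N} (X : TTFactors d r)
    (s : (i : Fin N) → Fin (d i)) :
    (k : Fin (N + 1)) → Matrix (Fin (r k)) (Fin (r (Fin.last N))) ℝ :=
  Fin.reverseInduction (motive := fun k => Matrix (Fin (r k)) (Fin (r (Fin.last N))) ℝ) 1
    (fun i Q => X i (s i) * Q)

/-- The tensor `[X_1, …, X_N]`: its `s`-th element is the only entry of the `1 × 1` matrix
`X_1(s_1) ⋯ X_N(s_N)`. -/
def ttTensor {N : ℕ} {d : Fin N → ℕ} {r : TTRanks N} (X : TTFactors d r) : Tensor d :=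
  fun s => ttPrefix X s (Fin.last N) ⟨0, r.pos _⟩ ⟨0, r.pos _⟩

/-- The left unfolding `L(X_i)`: the slices of one factor stacked on top of each other. -/
def leftUnfold {e p q : ℕ} (Y : Fin e → Matrix (Fin p) (Fin q) ℝ) :
    Matrix (Fin e × Fin p) (Fin q) ℝ :=
  Matrix.of fun sa b => Y sa.1 sa.2 b

/-- The inverse of `leftUnfold`. -/
def leftFold {e p q : ℕ} (M : Matrix (Fin e × Fin p) (Fin q) ℝ) :
    Fin e → Matrix (Fin p) (Fin q) ℝ :=
  fun s => Matrix.of fun a b => M (s, a) b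

/-- Left-orthogonal form: `L(X_i)ᵀ L(X_i) = I` for all factors but the last one. -/
def LeftOrthogonal {N : ℕ} {d : Fin N → ℕ} {r : TTRanks N} (X : TTFactors d r) : Prop :=
  ∀ i : InnerIdx N, (leftUnfold (X i.1))ᵀ * leftUnfold (X i.1) = 1

/-- The unfolding matrix of a tensor that takes the modes up to and including the `i`-th one as row
index and the other modes as column index. -/
def unfolding {N : ℕ} {d : Fin N → ℕ} (X : Tensor d) (i : Fin N) :
    Matrix ((j : {j : Fin N // j ≤ i}) → Fin (d j.1)) ((j : {j : Fin N // ¬ j ≤ i}) → Fin (d j.1)) ℝ :=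
  Matrix.of fun a b => X fun j => if h : j ≤ i then a ⟨j, h⟩ else b ⟨j, h⟩

/-- The `k`-th largest singular value `σ_k(M)`, counted from `k = 1`
(Mathlib counts singular values from zero). -/
def sing {m n : Type*} [Fintype m] [Fintype n] [DecidableEq n] (M : Matrix m n ℝ) (k : ℕ) : ℝ :=
  (Matrix.toEuclideanLin M).singularValues (k - 1)

/-- `σ̄(X) = max_{1 ≤ i ≤ N-1} σ_1(X^{⟨i⟩})`. -/
def sigmaMax {N : ℕ} {d : Fin N → ℕ} (X : Tensor d) : ℝ :=
  ⨆ i : InnerIdx N, sing (unfolding X i.1) 1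

/-- `σ̲(X) = min_{1 ≤ i ≤ N-1} σ_{r_i}(X^{⟨i⟩})`, for a tensor `X` with TT ranks `r`. -/
def sigmaMin {N : ℕ} {d : Fin N → ℕ} (r : TTRanks N) (X : Tensor d) : ℝ :=
  ⨅ i : InnerIdx N, sing (unfolding X i.1) (r i.1.succ)

/-- The condition number `κ(X) = σ̄(X) / σ̲(X)`. -/
def condNum {N : ℕ} {d : Fin N → ℕ} (r : TTRanks N) (X : Tensor d) : ℝ :=
  sigmaMax X / sigmaMin r X

/-- The rank-`R` `ℓ₁/ℓ₂`-restricted isometry property of the measurements `𝒜_1, …, 𝒜_m` with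
constant `δ`, over all tensors that have a TT decomposition with ranks at most `R`. -/
def L1L2RIP {N m : ℕ} {d : Fin N → ℕ} (A : Fin m → Tensor d) (R : ℕ) (δ : ℝ) : Prop :=
  ∀ r' : TTRanks N, (∀ i : InnerIdx N, r' i.1.succ ≤ R) → ∀ Z : TTFactors d r',
    (√(2 / Real.pi) - δ) * tnorm (ttTensor Z) ≤ (1 / m) * ∑ k, |tinner (A k) (ttTensor Z)| ∧
    (1 / m) * ∑ k, |tinner (A k) (ttTensor Z)| ≤ (√(2 / Real.pi) + δ) * tnorm (ttTensor Z)

/-- The fraction of outliers `p_s = ‖s‖₀ / m`. -/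
def outlierFraction {m : ℕ} (s : Fin m → ℝ) : ℝ :=
  ((Finset.univ.filter fun k => s k ≠ 0).card : ℝ) / m

/-- The sharpness property with constant `δ`, over all tensors in TT format with ranks `r`. -/
def Sharpness {N m : ℕ} {d : Fin N → ℕ} (r : TTRanks N) (A : Fin m → Tensor d)
    (Xs : Tensor d) (s : Fin m → ℝ) (δ : ℝ) : Prop :=
  ∀ Z : TTFactors d r,
    ((1 - 2 * outlierFraction s) * √(2 / Real.pi) - δ) * tnorm (ttTensor Z - Xs) ≤
      (1 / m) * ∑ k, |tinner (A k) (ttTensor Z - Xs) - s k| - (1 / m) * ∑ k, |s k|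

/-- The slice `∂_{X_i(s_i)} F` of the subgradient of
`F(X_1, …, X_N) = (1/m) ‖𝒜([X_1, …, X_N]) - y‖₁`, that is,
`(1/m) ∑_k sign(⟨𝒜_k, X⟩ - y_k) ∑ 𝒜_k(s) X_{i-1}(s_{i-1})ᵀ⋯X_1(s_1)ᵀ X_N(s_N)ᵀ⋯X_{i+1}(s_{i+1})ᵀ`,
where the inner sum runs over all `s` whose `i`-th entry is the given one. -/
def subgradSlice {N m : ℕ} {d : Fin N → ℕ} {r : TTRanks N} (A : Fin m → Tensor d)
    (y : Fin m → ℝ) (X : TTFactors d r) (i : Fin N) (si : Fin (d i)) :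
    Matrix (Fin (r i.castSucc)) (Fin (r i.succ)) ℝ :=
  (1 / m : ℝ) • ∑ k, Real.sign (tinner (A k) (ttTensor X) - y k) •
    ∑ s : (j : Fin N) → Fin (d j) with s i = si,
      A k s • Matrix.vecMulVec (fun a => ttPrefix X s i.castSucc ⟨0, r.pos _⟩ a)
        (fun b => ttSuffix X s i.succ b ⟨0, r.pos _⟩)

/-- The subgradient `∂_{L(X_i)} F`. -/
def subgrad {N m : ℕ} {d : Fin N → ℕ} {r : TTRanks N} (A : Fin m → Tensor d)
    (y : Fin m → ℝ) (X : TTFactors d r) (i : Fin N) :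
    Matrix (Fin (d i) × Fin (r i.castSucc)) (Fin (r i.succ)) ℝ :=
  leftUnfold (subgradSlice A y X i)

/-- The projection `U ↦ U - ½ L (Uᵀ L + Lᵀ U)` onto the tangent space of the Stiefel manifold
at `L`. -/
def tangentProj {m n : Type*} [Fintype m] [Fintype n] (L U : Matrix m n ℝ) : Matrix m n ℝ :=
  U - (1 / 2 : ℝ) • (L * (Uᵀ * L + Lᵀ * U))

/-- The polar retraction `G ↦ G (Gᵀ G)^{-1/2}`. -/
def polarRetr {m n : Type*} [Fintype m] [Fintype n] [DecidableEq n] (G : Matrix m n ℝ) :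
    Matrix m n ℝ :=
  G * cfc (fun x : ℝ => (√x)⁻¹) (Gᵀ * G)

/-- One step of the factorized Riemannian subgradient method with step size `μ`, where `σ` stands
for `σ̄(X*)`: a Riemannian subgradient step of size `μ / σ²` in each factor but the last one, and a
Euclidean subgradient step of size `μ` in the last one. -/
def frsubgmStep {N m : ℕ} {d : Fin N → ℕ} {r : TTRanks N} (A : Fin m → Tensor d)
    (y : Fin m → ℝ) (σ μ : ℝ) (X : TTFactors d r) : TTFactors d r := fun i =>
  if i.val + 1 < N then
    leftFold (polarRetr (leftUnfold (X i) -
      (μ / σ ^ 2) • tangentProj (leftUnfold (X i)) (subgrad A y X i)))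
  else
    leftFold (leftUnfold (X i) - μ • subgrad A y X i)

/-- The iterates of the factorized Riemannian subgradient method with step sizes `μ 0, μ 1, …`. -/
def frsubgm {N m : ℕ} {d : Fin N → ℕ} {r : TTRanks N} (A : Fin m → Tensor d)
    (y : Fin m → ℝ) (σ : ℝ) (μ : ℕ → ℝ) (X0 : TTFactors d r) : ℕ → TTFactors d r
  | 0 => X0
  | t + 1 => frsubgmStep A y σ (μ t) (frsubgm A y σ μ X0 t)

/-- Families of orthogonal matrices `R_0, …, R_N` of sizes `r_0, …, r_N` with `R_0 = R_N = 1`. -/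
abbrev Rotations {N : ℕ} (r : TTRanks N) : Type :=
  {R : (k : Fin (N + 1)) → Matrix.orthogonalGroup (Fin (r k)) ℝ // R 0 = 1 ∧ R (Fin.last N) = 1}

/-- The rotated factors, with slices `R_{i-1}ᵀ X_i(s) R_i`. -/
def rotate {N : ℕ} {d : Fin N → ℕ} {r : TTRanks N} (R : Rotations r) (X : TTFactors d r) :
    TTFactors d r := fun i s =>
  (R.1 i.castSucc : Matrix (Fin (r i.castSucc)) (Fin (r i.castSucc)) ℝ)ᵀ * X i s *
    (R.1 i.succ : Matrix (Fin (r i.succ)) (Fin (r i.succ)) ℝ)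

/-- The squared distance
`min_R ∑_{i<N} σ̄²(X*) ‖L(X_i) - L_R(X_i*)‖_F² + ‖L(X_N) - L_R(X_N*)‖₂²`
of two families of factors. -/
def distSq {N : ℕ} {d : Fin N → ℕ} {r : TTRanks N} (X Xs : TTFactors d r) : ℝ :=
  ⨅ R : Rotations r, ∑ i : Fin N,
    (if i.val + 1 < N then sigmaMax (ttTensor Xs) ^ 2 else 1) *
      frobSq (leftUnfold (X i) - leftUnfold (rotate R Xs i))

end RobustTT

end

open RobustTT

/-! Write τ = σ̄, σ = σ̲, a = (1 - 2p_s)√(2/π) - δ, c = √(2/π) + δ, e = ‖𝒳 - 𝒳*‖_F, and let D be the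
squared factor distance. Fix the rotation that is optimal for the current iterate and replace the
true factors by the aligned ones, which represent the same tensor. It then suffices to show that one
step brings the iterate closer to these fixed factors.

Expanding the squared distance after a step gives three contributions. The polar retraction costs
nothing: a tangent step G satisfies GᵀG ≥ I, and on such matrices the retraction does not increase
distances to orthonormal frames (`polarRetr_nonexpansive`). The squared subgradient norms are
bounded by the RIP and by operator norms of the suffix matrices. The cross term telescopes to the
pairing of the tensor subgradient with 𝒳 - 𝒳*, which sharpness bounds below by a·e, up to errors
quadratic in the factor differences (`sum_fip_stepDir_ge`). Together
(`weightedDistSq_frsubgmStep_le`): D_new ≤ D - 2μ(a e - (3N/4)(c/τ) D) + μ²(9N-5)c²/4.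

To close the recursion, e must dominate √D: `distSq_le_mul_tnorm_sq` gives D ≤ 8Sκ²e² near the
truth. Its proof compares the column spaces of the unfoldings (a sin-theta bound), aligns their
bases by orthogonal Procrustes, and recovers each factor from two consecutive prefix matrices.
Conversely e² ≤ N·D, so a small factor distance keeps the tensor in the region where all bounds
hold. The initialization makes D so small that the quadratic error uses at most half of a·e, and the
geometric step sizes turn the recursion into the factor q² (`step_contraction`). -/

namespace RobustTT

open scoped Kronecker

/-! ### Frobenius inner product and operator norm bounds. -/

section MatrixInequalities

variable {m n k : Type*} [Fintype m] [Fintype n] [Fintype k]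

/-- The Frobenius inner product of two real matrices. -/
def fip (M M' : Matrix m n ℝ) : ℝ := ∑ a, ∑ b, M a b * M' a b

theorem fip_self (M : Matrix m n ℝ) : fip M M = frobSq M := by
  simp only [fip, frobSq, sq]

theorem fip_comm (M M' : Matrix m n ℝ) : fip M M' = fip M' M := by
  simp only [fip, mul_comm]

theorem fip_add_left (A B C : Matrix m n ℝ) : fip (A + B) C = fip A C + fip B C := by
  simp only [fip, Matrix.add_apply, add_mul, Finset.sum_add_distrib]

theorem fip_sub_left (A B C : Matrix m n ℝ) : fip (A - B) C = fip A C - fip B C := by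
  simp only [fip, Matrix.sub_apply, sub_mul, Finset.sum_sub_distrib]

theorem fip_smul_left (c : ℝ) (A B : Matrix m n ℝ) : fip (c • A) B = c * fip A B := by
  simp only [fip, Matrix.smul_apply, smul_eq_mul, mul_assoc, Finset.mul_sum]

theorem fip_add_right (A B C : Matrix m n ℝ) : fip A (B + C) = fip A B + fip A C := by
  rw [fip_comm, fip_add_left, fip_comm B, fip_comm C]

theorem fip_sub_right (A B C : Matrix m n ℝ) : fip A (B - C) = fip A B - fip A C := by
  rw [fip_comm, fip_sub_left, fip_comm B, fip_comm C]

theorem fip_smul_right (c : ℝ) (A B : Matrix m n ℝ) : fip A (c • B) = c * fip A B := by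
  rw [fip_comm, fip_smul_left, fip_comm]

theorem fip_eq_trace (A B : Matrix m n ℝ) : fip A B = (Aᵀ * B).trace := by
  simp only [fip, Matrix.trace, Matrix.diag_apply, Matrix.mul_apply, Matrix.transpose_apply]
  exact Finset.sum_comm

theorem fip_transpose (A B : Matrix m n ℝ) : fip Aᵀ Bᵀ = fip A B := by
  simp only [fip, Matrix.transpose_apply]
  exact Finset.sum_comm

theorem fip_mul_left (A : Matrix m k ℝ) (B : Matrix k n ℝ) (C : Matrix m n ℝ) :
    fip (A * B) C = fip B (Aᵀ * C) := by
  rw [fip_eq_trace, fip_eq_trace, Matrix.transpose_mul, Matrix.mul_assoc]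

theorem fip_mul_right (A : Matrix m k ℝ) (B : Matrix k n ℝ) (C : Matrix m n ℝ) :
    fip (A * B) C = fip A (C * Bᵀ) := by
  rw [← fip_transpose, Matrix.transpose_mul, fip_mul_left, Matrix.transpose_transpose,
    ← fip_transpose A, Matrix.transpose_mul, Matrix.transpose_transpose]

theorem frobSq_nonneg (M : Matrix m n ℝ) : 0 ≤ frobSq M :=
  Finset.sum_nonneg fun _ _ => Finset.sum_nonneg fun _ _ => sq_nonneg _

theorem frobSq_transpose (M : Matrix m n ℝ) : frobSq Mᵀ = frobSq M := by
  rw [← fip_self, fip_transpose, fip_self]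

theorem frobSq_smul (c : ℝ) (M : Matrix m n ℝ) : frobSq (c • M) = c ^ 2 * frobSq M := by
  rw [← fip_self, fip_smul_left, fip_smul_right, fip_self]; ring

theorem frobSq_neg (M : Matrix m n ℝ) : frobSq (-M) = frobSq M := by
  simp [frobSq]

theorem frobSq_add (A B : Matrix m n ℝ) : frobSq (A + B) = frobSq A + 2 * fip A B + frobSq B := by
  simp only [← fip_self, fip_add_left, fip_add_right, fip_comm B A]; ring

theorem frobSq_sub (A B : Matrix m n ℝ) : frobSq (A - B) = frobSq A - 2 * fip A B + frobSq B := by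
  simp only [← fip_self, fip_sub_left, fip_sub_right, fip_comm B A]; ring

theorem frobSq_mul_of_isometry [DecidableEq k] {P : Matrix m k ℝ} (hP : Pᵀ * P = 1)
    (H : Matrix k n ℝ) : frobSq (P * H) = frobSq H := by
  rw [← fip_self, fip_mul_left, ← Matrix.mul_assoc, hP, Matrix.one_mul, fip_self]

/-- The Frobenius norm of a real matrix. -/
noncomputable def fnorm (M : Matrix m n ℝ) : ℝ := √(frobSq M)

theorem fnorm_nonneg (M : Matrix m n ℝ) : 0 ≤ fnorm M := Real.sqrt_nonneg _

theorem fnorm_sq (M : Matrix m n ℝ) : fnorm M ^ 2 = frobSq M := Real.sq_sqrt (frobSq_nonneg M)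

theorem fip_sq_le (A B : Matrix m n ℝ) : fip A B ^ 2 ≤ frobSq A * frobSq B := by
  simp only [fip, frobSq, ← Finset.sum_product']
  exact Finset.sum_mul_sq_le_sq_mul_sq _ _ _

theorem fip_le (A B : Matrix m n ℝ) : fip A B ≤ fnorm A * fnorm B := by
  rw [fnorm, fnorm, ← Real.sqrt_mul (frobSq_nonneg A)]
  exact Real.le_sqrt_of_sq_le (fip_sq_le A B)

theorem fnorm_add_le (A B : Matrix m n ℝ) : fnorm (A + B) ≤ fnorm A + fnorm B := by
  apply Real.sqrt_le_iff.2 ⟨add_nonneg (fnorm_nonneg _) (fnorm_nonneg _), ?_⟩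
  rw [frobSq_add, add_sq, fnorm_sq, fnorm_sq]
  linarith [fip_le A B]

theorem fnorm_sub_le (A B : Matrix m n ℝ) : fnorm (A - B) ≤ fnorm A + fnorm B := by
  have := fnorm_add_le A (-B)
  rwa [← sub_eq_add_neg, fnorm, fnorm, fnorm, frobSq_neg] at this

/-- `α` bounds the operator norm of `M` with respect to the Euclidean norms. -/
def OpBound (M : Matrix m n ℝ) (α : ℝ) : Prop :=
  ∀ v : n → ℝ, (M *ᵥ v) ⬝ᵥ (M *ᵥ v) ≤ α ^ 2 * (v ⬝ᵥ v)

theorem frobSq_eq_sum_col (M : Matrix m n ℝ) : frobSq M = ∑ b, M.col b ⬝ᵥ M.col b := by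
  simp only [frobSq, dotProduct, Matrix.col_apply, ← sq]
  exact Finset.sum_comm

theorem OpBound.frobSq_mul_le {M : Matrix m n ℝ} {α : ℝ} (h : OpBound M α) (H : Matrix n k ℝ) :
    frobSq (M * H) ≤ α ^ 2 * frobSq H := by
  rw [frobSq_eq_sum_col, frobSq_eq_sum_col, Finset.mul_sum]
  refine Finset.sum_le_sum fun b _ => ?_
  exact h (H.col b)

theorem dotProduct_sq_le (v w : n → ℝ) : (v ⬝ᵥ w) ^ 2 ≤ (v ⬝ᵥ v) * (w ⬝ᵥ w) := by
  simp only [dotProduct, ← sq]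
  exact Finset.sum_mul_sq_le_sq_mul_sq _ _ _

theorem dotProduct_self_nonneg' (v : n → ℝ) : 0 ≤ v ⬝ᵥ v :=
  Finset.sum_nonneg fun _ _ => mul_self_nonneg _

/-- ‖Mᵀv‖² = ⟨v, M Mᵀv⟩; apply Cauchy–Schwarz, then the bound on M at Mᵀv, and cancel one factor
‖Mᵀv‖². -/
theorem OpBound.transpose {M : Matrix m n ℝ} {α : ℝ} (h : OpBound M α) : OpBound Mᵀ α := by
  intro v
  set w := Mᵀ *ᵥ v with hw
  have h1 : w ⬝ᵥ w = v ⬝ᵥ (M *ᵥ w) := by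
    rw [Matrix.dotProduct_mulVec, ← Matrix.mulVec_transpose, Matrix.transpose_transpose,
      dotProduct_comm]
  have h2 := dotProduct_sq_le v (M *ᵥ w)
  rw [← h1] at h2
  have h3 := mul_le_mul_of_nonneg_left (h w) (dotProduct_self_nonneg' v)
  rcases (dotProduct_self_nonneg' w).eq_or_lt with h0 | h0
  · rw [← h0]; exact mul_nonneg (sq_nonneg _) (dotProduct_self_nonneg' v)
  · refine le_of_mul_le_mul_right ?_ h0
    nlinarith

theorem OpBound.frobSq_mul_le' {M : Matrix m n ℝ} {α : ℝ} (h : OpBound M α) (H : Matrix k m ℝ) :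
    frobSq (H * M) ≤ α ^ 2 * frobSq H := by
  rw [← frobSq_transpose, Matrix.transpose_mul, ← frobSq_transpose H]
  exact h.transpose.frobSq_mul_le _

theorem OpBound.of_frobSq_le {M : Matrix m n ℝ} {α : ℝ} (h : frobSq M ≤ α ^ 2) : OpBound M α := by
  intro v
  refine le_trans ?_ (mul_le_mul_of_nonneg_right h (dotProduct_self_nonneg' v))
  rw [frobSq, Finset.sum_mul]
  simp only [dotProduct, Matrix.mulVec, ← sq]
  exact Finset.sum_le_sum fun a _ => Finset.sum_mul_sq_le_sq_mul_sq _ _ _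

theorem OpBound.mono {M : Matrix m n ℝ} {α β : ℝ} (h : OpBound M α) (h0 : 0 ≤ α) (hab : α ≤ β) :
    OpBound M β := fun v =>
  (h v).trans (mul_le_mul_of_nonneg_right (pow_le_pow_left₀ h0 hab 2) (dotProduct_self_nonneg' v))

theorem OpBound.add {M M' : Matrix m n ℝ} {α β : ℝ} (h : OpBound M α) (h' : OpBound M' β)
    (hα : 0 ≤ α) (hβ : 0 ≤ β) : OpBound (M + M') (α + β) := by
  intro v
  have h1 := h v
  have h2 := h' v
  have h3 := dotProduct_sq_le (M *ᵥ v) (M' *ᵥ v)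
  have hv := dotProduct_self_nonneg' v
  have h4 : (M *ᵥ v) ⬝ᵥ (M' *ᵥ v) ≤ α * β * (v ⬝ᵥ v) := by
    refine abs_le_of_sq_le_sq' ?_ (by positivity) |>.2
    refine h3.trans ((mul_le_mul h1 h2 (dotProduct_self_nonneg' _) (by positivity)).trans_eq ?_)
    ring
  rw [Matrix.add_mulVec, add_dotProduct, dotProduct_add, dotProduct_add,
    dotProduct_comm (M' *ᵥ v) (M *ᵥ v)]
  nlinarith

theorem mulVec_dotProduct_of_isometry [DecidableEq n] {P : Matrix m n ℝ} (hP : Pᵀ * P = 1)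
    (v w : n → ℝ) : (P *ᵥ v) ⬝ᵥ (P *ᵥ w) = v ⬝ᵥ w := by
  rw [Matrix.dotProduct_mulVec, ← Matrix.mulVec_transpose, Matrix.mulVec_mulVec, hP,
    Matrix.one_mulVec]

theorem OpBound.of_isometry [DecidableEq n] {P : Matrix m n ℝ} (hP : Pᵀ * P = 1) :
    OpBound P 1 := fun v => by rw [mulVec_dotProduct_of_isometry hP]; simp

end MatrixInequalities

/-! ### Polar decomposition, polar retraction and the Procrustes problem. -/

section Polar

variable {m n : Type*} [Fintype m] [Fintype n] [DecidableEq n]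

theorem exists_eigenvector_of_mem_spectrum {A : Matrix n n ℝ} (hA : A.IsHermitian) {x : ℝ}
    (hx : x ∈ spectrum ℝ A) : ∃ v : n → ℝ, 0 < v ⬝ᵥ v ∧ A *ᵥ v = x • v := by
  rw [hA.spectrum_real_eq_range_eigenvalues] at hx
  obtain ⟨j, rfl⟩ := hx
  refine ⟨_, ?_, hA.mulVec_eigenvectorBasis j⟩
  have h : ‖hA.eigenvectorBasis j‖ = 1 := hA.eigenvectorBasis.orthonormal.1 j
  have h2 : ‖hA.eigenvectorBasis j‖ ^ 2 = 1 := by rw [h]; norm_num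
  rw [EuclideanSpace.real_norm_sq_eq] at h2
  simp only [dotProduct, ← sq]
  linarith

theorem le_of_mem_spectrum {A : Matrix n n ℝ} (hA : A.IsHermitian) {c : ℝ}
    (h : ∀ v, c * (v ⬝ᵥ v) ≤ v ⬝ᵥ (A *ᵥ v)) {x : ℝ} (hx : x ∈ spectrum ℝ A) : c ≤ x := by
  obtain ⟨v, hv, hv2⟩ := exists_eigenvector_of_mem_spectrum hA hx
  have := h v
  rw [hv2, dotProduct_smul, smul_eq_mul] at this
  exact le_of_mul_le_mul_right this hv

theorem mem_spectrum_le {A : Matrix n n ℝ} (hA : A.IsHermitian) {c : ℝ}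
    (h : ∀ v, v ⬝ᵥ (A *ᵥ v) ≤ c * (v ⬝ᵥ v)) {x : ℝ} (hx : x ∈ spectrum ℝ A) : x ≤ c := by
  obtain ⟨v, hv, hv2⟩ := exists_eigenvector_of_mem_spectrum hA hx
  have := h v
  rw [hv2, dotProduct_smul, smul_eq_mul] at this
  exact le_of_mul_le_mul_right this hv

theorem pos_of_mem_spectrum {A : Matrix n n ℝ} (hA : A.IsHermitian)
    (h : ∀ v, 0 < v ⬝ᵥ v → 0 < v ⬝ᵥ (A *ᵥ v)) {x : ℝ} (hx : x ∈ spectrum ℝ A) : 0 < x := by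
  obtain ⟨v, hv, hv2⟩ := exists_eigenvector_of_mem_spectrum hA hx
  have := h v hv
  rw [hv2, dotProduct_smul, smul_eq_mul] at this
  exact pos_of_mul_pos_left this hv.le

/-- The spectrum is finite, so the functional calculus accepts every function, including the inverse
square root, which is discontinuous at zero. -/
theorem continuousOn_real_spectrum (f : ℝ → ℝ) (A : Matrix n n ℝ) :
    ContinuousOn f (spectrum ℝ A) :=
  Matrix.finite_real_spectrum.continuousOn f

theorem transpose_cfc (f : ℝ → ℝ) (A : Matrix n n ℝ) : (cfc f A)ᵀ = cfc f A := by
  have h : IsSelfAdjoint (cfc f A) := IsSelfAdjoint.cfc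
  rw [← Matrix.conjTranspose_eq_transpose_of_trivial]
  exact h

omit [Fintype n] [DecidableEq n] in
theorem isHermitian_gram (G : Matrix m n ℝ) : (Gᵀ * G).IsHermitian := by
  simpa using Matrix.isHermitian_conjTranspose_mul_self G

/-- The Gram form lets inner products with a positive semidefinite matrix be read as inner products
of `B`, to which Cauchy–Schwarz applies. -/
theorem cfc_eq_transpose_mul_self_of_nonneg {f : ℝ → ℝ} {A : Matrix n n ℝ}
    (h : ∀ x ∈ spectrum ℝ A, 0 ≤ f x) : ∃ B : Matrix n n ℝ, cfc f A = Bᵀ * B := by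
  refine ⟨cfc (fun x => √(f x)) A, ?_⟩
  rw [transpose_cfc, ← cfc_mul _ _ A (continuousOn_real_spectrum _ A)
    (continuousOn_real_spectrum _ A)]
  exact cfc_congr fun x hx => (Real.mul_self_sqrt (h x hx)).symm

/-- The polar decomposition `G = W S` of a matrix of full column rank: `W` is the polar retraction,
and `S` is the square root of `Gᵀ G`. -/
theorem polarRetr_spec {G : Matrix m n ℝ}
    (h : ∀ v, 0 < v ⬝ᵥ v → 0 < v ⬝ᵥ ((Gᵀ * G) *ᵥ v)) :
    (polarRetr G)ᵀ * polarRetr G = 1 ∧ polarRetr G * cfc Real.sqrt (Gᵀ * G) = G := by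
  have hA := isHermitian_gram G
  set A := Gᵀ * G with hAdef
  have hsa : IsSelfAdjoint A := hA
  have hpos : ∀ x ∈ spectrum ℝ A, 0 < x := fun x hx => pos_of_mem_spectrum hA h hx
  have hc := fun f => continuousOn_real_spectrum f A
  have hid : cfc (fun x : ℝ => x) A = A := cfc_id' ℝ A
  constructor
  · rw [polarRetr, Matrix.transpose_mul, transpose_cfc, Matrix.mul_assoc, ← Matrix.mul_assoc Gᵀ,
      ← hAdef]
    conv_lhs => enter [2, 1]; rw [← hid]
    rw [← cfc_mul _ _ A (hc _) (hc _), ← cfc_mul _ _ A (hc _) (hc _), ← cfc_const_one ℝ A]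
    refine cfc_congr fun x hx => ?_
    have hx := hpos x hx
    have h2 : √x ≠ 0 := (Real.sqrt_pos.2 hx).ne'
    have h3 := Real.mul_self_sqrt hx.le
    field_simp
    rw [sq, h3]
  · rw [polarRetr, ← hAdef, Matrix.mul_assoc, ← cfc_mul _ _ A (hc _) (hc _)]
    have : cfc (fun x : ℝ => (√x)⁻¹ * √x) A = 1 := by
      rw [← cfc_const_one ℝ A]
      exact cfc_congr fun x hx => inv_mul_cancel₀ (Real.sqrt_pos.2 (hpos x hx)).ne'
    rw [this, Matrix.mul_one]

/-- The polar retraction does not increase the distance to matrices with orthonormal columns. -/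
theorem polarRetr_nonexpansive {G : Matrix m n ℝ}
    (h : ∀ v, v ⬝ᵥ v ≤ v ⬝ᵥ ((Gᵀ * G) *ᵥ v)) :
    (polarRetr G)ᵀ * polarRetr G = 1 ∧
      ∀ L : Matrix m n ℝ, Lᵀ * L = 1 → frobSq (polarRetr G - L) ≤ frobSq (G - L) := by
  obtain ⟨h1, h2⟩ := polarRetr_spec (G := G) fun v hv => hv.trans_le (h v)
  refine ⟨h1, fun L hL => ?_⟩
  have hA := isHermitian_gram G
  have hsa : IsSelfAdjoint (Gᵀ * G) := hA
  obtain ⟨B, hB⟩ := cfc_eq_transpose_mul_self_of_nonneg (f := fun x => √x - 1) (A := Gᵀ * G)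
    fun x hx => sub_nonneg.2 (Real.one_le_sqrt.2
      (le_of_mem_spectrum hA (fun v => by simpa using h v) hx))
  rw [cfc_sub _ _ (Gᵀ * G) (continuousOn_real_spectrum _ _) (continuousOn_real_spectrum _ _),
    cfc_const_one ℝ (Gᵀ * G)] at hB
  set W := polarRetr G
  -- Here BᵀB = √(GᵀG) - I. The defect G - W pairs with W to ‖B‖², and with any other orthonormal
  -- frame L to at most ‖B‖². Hence the cross term of ‖(G - W) + (W - L)‖² is nonnegative.
  have hGW : G - W = W * (Bᵀ * B) := by rw [← hB, Matrix.mul_sub, h2, Matrix.mul_one]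
  have hWB : fip (G - W) W = frobSq Bᵀ := by
    rw [hGW, fip_mul_left, h1, fip_mul_right, Matrix.one_mul, fip_self]
  have hLB : fip (G - W) L ≤ frobSq Bᵀ := by
    have e : fip (G - W) L = fip (W * Bᵀ) (L * Bᵀ) := by
      rw [hGW, ← Matrix.mul_assoc, fip_mul_right]
    have h3 := fip_le (W * Bᵀ) (L * Bᵀ)
    rw [← e, fnorm, fnorm, frobSq_mul_of_isometry h1, frobSq_mul_of_isometry hL,
      Real.mul_self_sqrt (frobSq_nonneg _)] at h3
    exact h3
  have e : G - L = (G - W) + (W - L) := by abel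
  rw [e, frobSq_add, fip_sub_right]
  linarith [frobSq_nonneg (G - W)]

/-- Orthogonal Procrustes problem: two orthonormal bases of subspaces at distance less than one
can be aligned up to a factor `√2` of that distance. -/
theorem exists_orthogonal_frobSq_sub_le {P P' : Matrix m n ℝ} (hP : Pᵀ * P = 1)
    (hP' : P'ᵀ * P' = 1) (h : frobSq (P' - P * (Pᵀ * P')) < 1) :
    ∃ R : Matrix n n ℝ, Rᵀ * R = 1 ∧
      frobSq (P - P' * R) ≤ 2 * frobSq (P' - P * (Pᵀ * P')) := by
  set M : Matrix n n ℝ := P'ᵀ * P with hM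
  have hMt : Pᵀ * P' = Mᵀ := by rw [hM, Matrix.transpose_mul, Matrix.transpose_transpose]
  rw [hMt] at h ⊢
  have hgram : ∀ v : n → ℝ, v ⬝ᵥ ((M * Mᵀ) *ᵥ v) =
      v ⬝ᵥ v - ((P' - P * Mᵀ) *ᵥ v) ⬝ᵥ ((P' - P * Mᵀ) *ᵥ v) := by
    intro v
    have e1 : (P' - P * Mᵀ)ᵀ * (P' - P * Mᵀ) = 1 - M * Mᵀ := by
      rw [Matrix.transpose_sub, Matrix.transpose_mul, Matrix.transpose_transpose, Matrix.sub_mul,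
        Matrix.mul_sub, Matrix.mul_sub, hP', Matrix.mul_assoc M Pᵀ P', hMt,
        Matrix.mul_assoc M Pᵀ, ← Matrix.mul_assoc Pᵀ, hP, Matrix.one_mul,
        ← Matrix.mul_assoc P'ᵀ, ← hM]
      abel
    rw [Matrix.dotProduct_mulVec ((P' - P * Mᵀ) *ᵥ v), ← Matrix.mulVec_transpose,
      Matrix.mulVec_mulVec, e1, Matrix.sub_mulVec, Matrix.one_mulVec, sub_dotProduct,
      dotProduct_comm ((M * Mᵀ) *ᵥ v)]
    ring
  -- A sine below one makes M Mᵀ positive definite, so the polar factor of Mᵀ is a genuine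
  -- orthogonal matrix.
  have hlt : ∀ v : n → ℝ, 0 < v ⬝ᵥ v → 0 < v ⬝ᵥ ((M * Mᵀ) *ᵥ v) := by
    intro v hv
    have h1 : OpBound (P' - P * Mᵀ) (fnorm (P' - P * Mᵀ)) :=
      OpBound.of_frobSq_le (fnorm_sq _).ge
    have := h1 v
    rw [fnorm_sq] at this
    rw [hgram]
    nlinarith
  have hle : ∀ v : n → ℝ, v ⬝ᵥ ((M * Mᵀ) *ᵥ v) ≤ 1 * (v ⬝ᵥ v) := by
    intro v
    rw [hgram]
    linarith [dotProduct_self_nonneg' ((P' - P * Mᵀ) *ᵥ v)]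
  obtain ⟨h1, h2⟩ := polarRetr_spec (G := Mᵀ) (by simpa using hlt)
  have hA := isHermitian_gram Mᵀ
  have hsa : IsSelfAdjoint (Mᵀᵀ * Mᵀ) := hA
  set W := polarRetr Mᵀ
  have hc := fun f => continuousOn_real_spectrum f (Mᵀᵀ * Mᵀ)
  -- The eigenvalues of M Mᵀ are squared cosines in (0, 1], where √x ≥ x. Taking traces gives ⟨W,
  -- Mᵀ⟩ ≥ ‖M‖². The two sides of the claim are 2(n - ⟨W, Mᵀ⟩) and 2(n - ‖M‖²), which is where the
  -- factor 2 comes from.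
  obtain ⟨B, hB⟩ := cfc_eq_transpose_mul_self_of_nonneg (f := fun x => √x - x) (A := Mᵀᵀ * Mᵀ)
    fun x hx => by
      have hx1 : x ≤ 1 := mem_spectrum_le hA (by simpa using hle) hx
      have hx0 : 0 < x := pos_of_mem_spectrum hA (by simpa using hlt) hx
      exact sub_nonneg.2 (Real.le_sqrt_of_sq_le (by nlinarith))
  rw [cfc_sub _ _ _ (hc _) (hc _), cfc_id' ℝ (Mᵀᵀ * Mᵀ)] at hB
  have htr : frobSq Mᵀ ≤ fip W Mᵀ := by
    have e1 : fip W Mᵀ = (cfc Real.sqrt (Mᵀᵀ * Mᵀ)).trace := by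
      conv_lhs => rw [← h2]
      rw [fip_eq_trace, ← Matrix.mul_assoc, h1, Matrix.one_mul]
    have e2 : frobSq Mᵀ = (Mᵀᵀ * Mᵀ).trace := by rw [← fip_self, fip_eq_trace]
    have e3 : frobSq B = (Bᵀ * B).trace := by rw [← fip_self, fip_eq_trace]
    have := frobSq_nonneg B
    rw [e3, ← hB, Matrix.trace_sub] at this
    linarith
  refine ⟨Wᵀ, ?_, ?_⟩
  · rw [Matrix.transpose_transpose]; exact mul_eq_one_comm.1 h1
  · have e1 : frobSq (P' * Wᵀ) = frobSq (1 : Matrix n n ℝ) := by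
      rw [frobSq_mul_of_isometry hP', frobSq_transpose, ← Matrix.mul_one W, frobSq_mul_of_isometry h1]
    have e2 : frobSq P = frobSq (1 : Matrix n n ℝ) := by
      conv_lhs => rw [← Matrix.mul_one P]
      exact frobSq_mul_of_isometry hP _
    have e3 : frobSq P' = frobSq (1 : Matrix n n ℝ) := by
      conv_lhs => rw [← Matrix.mul_one P']
      exact frobSq_mul_of_isometry hP' _
    have e4 : fip P (P' * Wᵀ) = fip W Mᵀ := by
      rw [fip_comm, fip_mul_left, ← hM, ← fip_transpose, Matrix.transpose_transpose]
    have e5 : fip P' (P * Mᵀ) = frobSq Mᵀ := by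
      rw [fip_comm, fip_mul_left, hMt, fip_self]
    rw [frobSq_sub, frobSq_sub, e1, e2, e3, e4, e5, frobSq_mul_of_isometry hP]
    linarith

end Polar

/-! ### Tangent projections and retracted steps on the Stiefel manifold. -/

section Tangent

variable {m n : Type*} [Fintype m] [Fintype n] [DecidableEq n]

theorem transpose_mul_tangentProj {L : Matrix m n ℝ} (hL : Lᵀ * L = 1) (U : Matrix m n ℝ) :
    Lᵀ * tangentProj L U = (1 / 2 : ℝ) • (Lᵀ * U - Uᵀ * L) := by
  rw [tangentProj, Matrix.mul_sub, Matrix.mul_smul, ← Matrix.mul_assoc, hL, Matrix.one_mul]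
  module

/-- Lᵀ times a tangent vector is skew, and skew matrices are orthogonal to symmetric ones. -/
theorem fip_tangentProj_mul {L : Matrix m n ℝ} (hL : Lᵀ * L = 1) (U : Matrix m n ℝ)
    {T : Matrix n n ℝ} (hT : Tᵀ = T) : fip (tangentProj L U) (L * T) = 0 := by
  rw [fip_comm, fip_mul_left, transpose_mul_tangentProj hL, fip_smul_right, fip_sub_right,
    ← fip_transpose T (Uᵀ * L), hT, Matrix.transpose_mul, Matrix.transpose_transpose, sub_self,
    mul_zero]

theorem frobSq_tangentProj_le {L : Matrix m n ℝ} (hL : Lᵀ * L = 1) (U : Matrix m n ℝ) :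
    frobSq (tangentProj L U) ≤ frobSq U := by
  have e : U = tangentProj L U + L * ((1 / 2 : ℝ) • (Uᵀ * L + Lᵀ * U)) := by
    rw [tangentProj, Matrix.mul_smul]; abel
  have h := fip_tangentProj_mul hL U (T := (1 / 2 : ℝ) • (Uᵀ * L + Lᵀ * U)) (by
    rw [Matrix.transpose_smul, Matrix.transpose_add, Matrix.transpose_mul, Matrix.transpose_mul,
      Matrix.transpose_transpose, Matrix.transpose_transpose, add_comm])
  conv_rhs => rw [e]
  rw [frobSq_add, h]
  linarith [frobSq_nonneg (L * ((1 / 2 : ℝ) • (Uᵀ * L + Lᵀ * U)))]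

/-- Pairing a tangent projection with the difference of two points of the Stiefel manifold. -/
theorem fip_tangentProj_sub {L L' : Matrix m n ℝ} (hL : Lᵀ * L = 1) (hL' : L'ᵀ * L' = 1)
    (U : Matrix m n ℝ) :
    fip (tangentProj L U) (L - L') =
      fip U (L - L') - fip U ((1 / 2 : ℝ) • (L * ((L - L')ᵀ * (L - L')))) := by
  have e : (L - L')ᵀ * (L - L') = L'ᵀ * (L' - L) + (L' - L)ᵀ * L' := by
    simp only [Matrix.transpose_sub, Matrix.sub_mul, Matrix.mul_sub, hL, hL']; abel
  -- Both frames are orthonormal, so the symmetric part of Lᵀ(L - L') is quadratic in L - L'. By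
  -- self-adjointness of the projection, projecting U therefore changes the pairing with the chord
  -- only to second order.
  have e2 : (L - L')ᵀ * (L - L') = Lᵀ * (L - L') + (L - L')ᵀ * L := by
    simp only [Matrix.transpose_sub, Matrix.sub_mul, Matrix.mul_sub, hL, hL']; abel
  have h3 : ∀ D : Matrix m n ℝ, fip (L * (Uᵀ * L + Lᵀ * U)) D =
      fip U (L * (Lᵀ * D + Dᵀ * L)) := by
    intro D
    rw [fip_mul_left, fip_add_left, ← fip_transpose (Uᵀ * L), Matrix.transpose_mul,
      Matrix.transpose_transpose, ← fip_add_right, fip_mul_left, Matrix.transpose_transpose,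
      Matrix.transpose_mul, Matrix.transpose_transpose, add_comm]
  rw [tangentProj, fip_sub_left, fip_smul_left, fip_smul_right, h3, e2]

/-- Moving from a point `L` of the Stiefel manifold in a tangent direction and retracting. -/
theorem polarRetr_tangent {L : Matrix m n ℝ} (hL : Lᵀ * L = 1) (η : ℝ) (U : Matrix m n ℝ) :
    (polarRetr (L - η • tangentProj L U))ᵀ * polarRetr (L - η • tangentProj L U) = 1 ∧
      ∀ L' : Matrix m n ℝ, L'ᵀ * L' = 1 →
        frobSq (polarRetr (L - η • tangentProj L U) - L') ≤
          frobSq (L - η • tangentProj L U - L') := by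
  apply polarRetr_nonexpansive
  intro v
  set ξ := tangentProj L U with hξ
  -- Tangency cancels the first-order terms, leaving the Gram matrix I + η²ξᵀξ ≥ I, as
  -- nonexpansiveness of the retraction requires.
  have h1 : Lᵀ * ξ + ξᵀ * L = 0 := by
    have e := transpose_mul_tangentProj hL U
    have e' : ξᵀ * L = (Lᵀ * ξ)ᵀ := by rw [Matrix.transpose_mul, Matrix.transpose_transpose]
    rw [e', hξ, e]
    simp only [Matrix.transpose_smul, Matrix.transpose_sub, Matrix.transpose_mul,
      Matrix.transpose_transpose]
    module
  have h2 : (L - η • ξ)ᵀ * (L - η • ξ) = 1 + (η • ξ)ᵀ * (η • ξ) := by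
    have : (L - η • ξ)ᵀ * (L - η • ξ) =
        Lᵀ * L - η • (Lᵀ * ξ + ξᵀ * L) + (η • ξ)ᵀ * (η • ξ) := by
      simp only [Matrix.transpose_sub, Matrix.transpose_smul, Matrix.sub_mul, Matrix.mul_sub,
        Matrix.smul_mul, Matrix.mul_smul]
      module
    rw [this, h1, hL, smul_zero, sub_zero]
  rw [h2, Matrix.add_mulVec, Matrix.one_mulVec, dotProduct_add, ← Matrix.mulVec_mulVec,
    Matrix.dotProduct_mulVec v (η • ξ)ᵀ, Matrix.vecMul_transpose]
  linarith [dotProduct_self_nonneg' ((η • ξ) *ᵥ v)]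

end Tangent

/-! ### Largest and smallest nonzero singular values as bounds on matrix action. -/

section SingularValues

open Module

variable {E F : Type*} [NormedAddCommGroup E] [InnerProductSpace ℝ E] [FiniteDimensional ℝ E]
  [NormedAddCommGroup F] [InnerProductSpace ℝ F] [FiniteDimensional ℝ F]

theorem norm_sq_apply_eq_sum_singularValues (T : E →ₗ[ℝ] F) (w : E) :
    ‖T w‖ ^ 2 = ∑ i : Fin (finrank ℝ E), T.singularValues i ^ 2 *
      (T.isSymmetric_adjoint_comp_self.eigenvectorBasis rfl).repr w i ^ 2 := by
  set hT := T.isSymmetric_adjoint_comp_self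
  have h1 : ‖T w‖ ^ 2 = inner ℝ ((T.adjoint ∘ₗ T) w) w := by
    rw [LinearMap.comp_apply, LinearMap.adjoint_inner_left, real_inner_self_eq_norm_sq]
  rw [h1, ← (hT.eigenvectorBasis rfl).repr.inner_map_map, PiLp.inner_apply]
  refine Finset.sum_congr rfl fun i _ => ?_
  rw [hT.eigenvectorBasis_apply_self_apply rfl w i, T.sq_singularValues_fin rfl i]
  simp
  ring

theorem norm_sq_adjoint_apply_eq_sum_singularValues (T : E →ₗ[ℝ] F) (w : E) :
    ‖T.adjoint (T w)‖ ^ 2 = ∑ i : Fin (finrank ℝ E), (T.singularValues i ^ 2) ^ 2 *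
      (T.isSymmetric_adjoint_comp_self.eigenvectorBasis rfl).repr w i ^ 2 := by
  set hT := T.isSymmetric_adjoint_comp_self
  have h1 : T.adjoint (T w) = (T.adjoint ∘ₗ T) w := rfl
  rw [h1, ← (hT.eigenvectorBasis rfl).repr.norm_map, EuclideanSpace.real_norm_sq_eq]
  refine Finset.sum_congr rfl fun i _ => ?_
  rw [hT.eigenvectorBasis_apply_self_apply rfl w i, T.sq_singularValues_fin rfl i]
  simp
  ring

theorem norm_sq_apply_le_singularValues_zero (T : E →ₗ[ℝ] F) (w : E) :
    ‖T w‖ ^ 2 ≤ T.singularValues 0 ^ 2 * ‖w‖ ^ 2 := by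
  rw [norm_sq_apply_eq_sum_singularValues,
    ← (T.isSymmetric_adjoint_comp_self.eigenvectorBasis rfl).repr.norm_map w,
    EuclideanSpace.real_norm_sq_eq, Finset.mul_sum]
  refine Finset.sum_le_sum fun i _ => mul_le_mul_of_nonneg_right ?_ (sq_nonneg _)
  exact pow_le_pow_left₀ (T.singularValues_nonneg _) (T.singularValues_antitone (Nat.zero_le _)) 2

/-- Both norms are diagonal in the same eigenbasis of T*T. Coordinates below the rank carry singular
values at least the one on the left, and the others contribute zero. In rank zero the truncated
index is 0, and only vanishing terms occur. -/
theorem singularValues_mul_norm_sq_le (T : E →ₗ[ℝ] F) (w : E) :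
    T.singularValues (finrank ℝ T.range - 1) ^ 2 * ‖T w‖ ^ 2 ≤ ‖T.adjoint (T w)‖ ^ 2 := by
  rw [norm_sq_apply_eq_sum_singularValues, norm_sq_adjoint_apply_eq_sum_singularValues,
    Finset.mul_sum]
  refine Finset.sum_le_sum fun i _ => ?_
  rw [← mul_assoc]
  refine mul_le_mul_of_nonneg_right ?_ (sq_nonneg _)
  rcases lt_or_ge (i : ℕ) (finrank ℝ T.range) with h | h
  · rw [sq (_ ^ 2)]
    refine mul_le_mul_of_nonneg_right ?_ (sq_nonneg _)
    exact pow_le_pow_left₀ (T.singularValues_nonneg _)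
      (T.singularValues_antitone (Nat.le_sub_one_of_lt h)) 2
  · rw [T.singularValues_eq_zero_iff_le_finrank_range.2 h]; simp

variable {m n : Type*} [Fintype m] [Fintype n] [DecidableEq n]

theorem sing_nonneg (M : Matrix m n ℝ) (k : ℕ) : 0 ≤ sing M k :=
  LinearMap.singularValues_nonneg _ _

theorem sing_antitone (M : Matrix m n ℝ) : Antitone (sing M) := fun _ _ h =>
  LinearMap.singularValues_antitone _ (Nat.sub_le_sub_right h 1)

theorem finrank_range_toEuclideanLin (M : Matrix m n ℝ) :
    finrank ℝ (Matrix.toEuclideanLin M).range = M.rank := by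
  rw [Matrix.rank_eq_finrank_range_toLin M (EuclideanSpace.basisFun m ℝ).toBasis
    (EuclideanSpace.basisFun n ℝ).toBasis, Matrix.toEuclideanLin_eq_toLin_orthonormal]

theorem sing_rank_pos (M : Matrix m n ℝ) (h : 0 < M.rank) : 0 < sing M M.rank := by
  rw [sing, LinearMap.singularValues_pos_iff_lt_finrank_range, finrank_range_toEuclideanLin]
  omega

omit [DecidableEq n] in
theorem norm_sq_toLp (v : n → ℝ) : ‖WithLp.toLp 2 v‖ ^ 2 = v ⬝ᵥ v := by
  rw [EuclideanSpace.real_norm_sq_eq]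
  simp only [dotProduct, sq]

theorem OpBound.sing_one [DecidableEq m] (M : Matrix m n ℝ) : OpBound M (sing M 1) := by
  intro v
  have := norm_sq_apply_le_singularValues_zero (Matrix.toEuclideanLin M) (WithLp.toLp 2 v)
  rwa [Matrix.toLpLin_toLp, norm_sq_toLp, norm_sq_toLp] at this

theorem sing_rank_mul_le [DecidableEq m] (M : Matrix m n ℝ) (w : n → ℝ) :
    sing M M.rank ^ 2 * ((M *ᵥ w) ⬝ᵥ (M *ᵥ w)) ≤
      (Mᵀ *ᵥ (M *ᵥ w)) ⬝ᵥ (Mᵀ *ᵥ (M *ᵥ w)) := by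
  have := singularValues_mul_norm_sq_le (Matrix.toEuclideanLin M) (WithLp.toLp 2 w)
  rwa [← Matrix.toEuclideanLin_conjTranspose_eq_adjoint, finrank_range_toEuclideanLin,
    Matrix.toLpLin_toLp, Matrix.toLpLin_toLp, norm_sq_toLp, norm_sq_toLp,
    Matrix.conjTranspose_eq_transpose_of_trivial] at this

/-- If `P Q` is a full rank factorization with orthonormal columns of `P`, then the smallest
nonzero singular value of `P Q` is a lower bound for the action of `Q` from the right. -/
theorem sing_rank_mul_frobSq_le [DecidableEq m] {r : ℕ} {k : Type*} [Fintype k]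
    {P : Matrix m (Fin r) ℝ} {Q : Matrix (Fin r) n ℝ}
    (hP : Pᵀ * P = 1) (hr : (P * Q).rank = r) (H : Matrix k (Fin r) ℝ) :
    sing (P * Q) r ^ 2 * frobSq H ≤ frobSq (H * Q) := by
  -- Full rank makes every P h a value P Q w. Since (P Q)ᵀ P h = Qᵀ h, the lower bound for Mᵀ on the
  -- range of M = P Q becomes a lower bound for Qᵀ on all vectors.
  have hrange : (P * Q).mulVecLin.range = P.mulVecLin.range := by
    apply Submodule.eq_of_le_of_finrank_le
    · rintro _ ⟨w, rfl⟩
      exact ⟨Q *ᵥ w, by simp⟩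
    · have h1 : P.rank ≤ r := by simpa using P.rank_le_card_width
      exact h1.trans hr.ge
  have key : ∀ h : Fin r → ℝ, sing (P * Q) r ^ 2 * (h ⬝ᵥ h) ≤ (Qᵀ *ᵥ h) ⬝ᵥ (Qᵀ *ᵥ h) := by
    intro h
    have hmem : P *ᵥ h ∈ (P * Q).mulVecLin.range := by rw [hrange]; exact ⟨h, rfl⟩
    obtain ⟨w, hw⟩ := hmem
    rw [Matrix.mulVecLin_apply] at hw
    have h1 := sing_rank_mul_le (P * Q) w
    rw [hr, hw, mulVec_dotProduct_of_isometry hP, Matrix.mulVec_mulVec, Matrix.transpose_mul,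
      Matrix.mul_assoc, hP, Matrix.mul_one] at h1
    exact h1
  rw [← frobSq_transpose H, ← frobSq_transpose (H * Q), frobSq_eq_sum_col, frobSq_eq_sum_col,
    Matrix.transpose_mul, Finset.mul_sum]
  exact Finset.sum_le_sum fun b _ => key (Hᵀ.col b)

end SingularValues

/-! ### Slice products and multilinearity of the tensor train map. -/

section TensorTrain

variable {N : ℕ} {d : Fin N → ℕ} {r : TTRanks N}

theorem ttPrefix_zero (X : TTFactors d r) (s : (i : Fin N) → Fin (d i)) : ttPrefix X s 0 = 1 := rfl

theorem ttPrefix_succ (X : TTFactors d r) (s : (i : Fin N) → Fin (d i)) (i : Fin N) :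
    ttPrefix X s i.succ = ttPrefix X s i.castSucc * X i (s i) :=
  Fin.induction_succ _ _ _

theorem ttSuffix_last (X : TTFactors d r) (s : (i : Fin N) → Fin (d i)) :
    ttSuffix X s (Fin.last N) = 1 :=
  Fin.reverseInduction_last

theorem ttSuffix_castSucc (X : TTFactors d r) (s : (i : Fin N) → Fin (d i)) (i : Fin N) :
    ttSuffix X s i.castSucc = X i (s i) * ttSuffix X s i.succ :=
  Fin.reverseInduction_castSucc _

theorem ttPrefix_mul_ttSuffix (X : TTFactors d r) (s : (i : Fin N) → Fin (d i))
    (k : Fin (N + 1)) : ttPrefix X s k * ttSuffix X s k = ttPrefix X s (Fin.last N) := by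
  induction k using Fin.reverseInduction with
  | last => rw [ttSuffix_last, Matrix.mul_one]
  | cast i ih => rw [ttSuffix_castSucc, ← Matrix.mul_assoc, ← ttPrefix_succ, ih]

theorem ttPrefix_congr {X X' : TTFactors d r} {s s' : (i : Fin N) → Fin (d i)} {k : Fin (N + 1)}
    (h : ∀ j : Fin N, j.castSucc < k → X j (s j) = X' j (s' j)) :
    ttPrefix X s k = ttPrefix X' s' k := by
  induction k using Fin.induction with
  | zero => rfl
  | succ i ih =>
    rw [ttPrefix_succ, ttPrefix_succ, h i (Fin.castSucc_lt_succ),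
      ih fun j hj => h j (hj.trans Fin.castSucc_lt_succ)]

theorem ttSuffix_congr {X X' : TTFactors d r} {s s' : (i : Fin N) → Fin (d i)} {k : Fin (N + 1)}
    (h : ∀ j : Fin N, k ≤ j.castSucc → X j (s j) = X' j (s' j)) :
    ttSuffix X s k = ttSuffix X' s' k := by
  induction k using Fin.reverseInduction with
  | last => rw [ttSuffix_last, ttSuffix_last]
  | cast i ih =>
    rw [ttSuffix_castSucc, ttSuffix_castSucc, h i le_rfl,
      ih fun j hj => h j ((Fin.castSucc_lt_succ).le.trans hj)]

/-- The row vector `X_1(s_1) ⋯ X_k(s_k)`. -/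
def preVec (X : TTFactors d r) (s : (i : Fin N) → Fin (d i)) (k : Fin (N + 1)) :
    Fin (r k) → ℝ := fun a => ttPrefix X s k ⟨0, r.pos _⟩ a

/-- The column vector `X_{k+1}(s_{k+1}) ⋯ X_N(s_N)`. -/
def sufVec (X : TTFactors d r) (s : (i : Fin N) → Fin (d i)) (k : Fin (N + 1)) :
    Fin (r k) → ℝ := fun b => ttSuffix X s k b ⟨0, r.pos _⟩

theorem preVec_succ (X : TTFactors d r) (s : (i : Fin N) → Fin (d i)) (i : Fin N) :
    preVec X s i.succ = preVec X s i.castSucc ᵥ* X i (s i) := by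
  ext b
  rw [preVec, ttPrefix_succ]; rfl

theorem sufVec_castSucc (X : TTFactors d r) (s : (i : Fin N) → Fin (d i)) (i : Fin N) :
    sufVec X s i.castSucc = X i (s i) *ᵥ sufVec X s i.succ := by
  ext b
  rw [sufVec, ttSuffix_castSucc]; rfl

theorem preVec_congr {X X' : TTFactors d r} {s s' : (i : Fin N) → Fin (d i)} {k : Fin (N + 1)}
    (h : ∀ j : Fin N, j.castSucc < k → X j (s j) = X' j (s' j)) :
    preVec X s k = preVec X' s' k := by
  ext; simp only [preVec, ttPrefix_congr h]

theorem sufVec_congr {X X' : TTFactors d r} {s s' : (i : Fin N) → Fin (d i)} {k : Fin (N + 1)}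
    (h : ∀ j : Fin N, k ≤ j.castSucc → X j (s j) = X' j (s' j)) :
    sufVec X s k = sufVec X' s' k := by
  ext; simp only [sufVec, ttSuffix_congr h]

theorem ttTensor_eq_dotProduct (X : TTFactors d r) (s : (i : Fin N) → Fin (d i))
    (k : Fin (N + 1)) : ttTensor X s = preVec X s k ⬝ᵥ sufVec X s k := by
  rw [ttTensor, ← ttPrefix_mul_ttSuffix X s k]; rfl

/-- Isolating one slice between an untouched prefix and suffix yields both multilinearity and the
chain rule. -/
theorem ttTensor_update (X : TTFactors d r) (i : Fin N)
    (H : Fin (d i) → Matrix (Fin (r i.castSucc)) (Fin (r i.succ)) ℝ)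
    (s : (i : Fin N) → Fin (d i)) :
    ttTensor (Function.update X i H) s =
      preVec X s i.castSucc ⬝ᵥ (H (s i) *ᵥ sufVec X s i.succ) := by
  rw [ttTensor_eq_dotProduct _ s i.castSucc, sufVec_castSucc, Function.update_self,
    preVec_congr (X := Function.update X i H) (X' := X) (s' := s),
    sufVec_congr (X := Function.update X i H) (X' := X) (s' := s)]
  · intro j hj
    rw [Function.update_of_ne]
    rintro rfl
    exact absurd hj (not_le.2 Fin.castSucc_lt_succ)
  · intro j hj
    rw [Function.update_of_ne]
    rintro rfl
    exact lt_irrefl _ hj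

/-- The tensor train map is linear in every factor. -/
def ttMultilinear (d : Fin N → ℕ) (r : TTRanks N) :
    MultilinearMap ℝ (fun i : Fin N => Fin (d i) → Matrix (Fin (r i.castSucc)) (Fin (r i.succ)) ℝ)
      (Tensor d) where
  toFun X := ttTensor X
  map_update_add' := by
    intro inst X i H H'
    -- Multilinearity is stated for an arbitrary decidable equality, which has to be identified with
    -- the canonical one.
    obtain rfl : inst = instDecidableEqFin N := Subsingleton.elim _ _
    ext s
    rw [Pi.add_apply, ttTensor_update, ttTensor_update, ttTensor_update, Pi.add_apply,
      Matrix.add_mulVec, dotProduct_add]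
  map_update_smul' := by
    intro inst X i c H
    obtain rfl : inst = instDecidableEqFin N := Subsingleton.elim _ _
    ext s
    rw [Pi.smul_apply, ttTensor_update, ttTensor_update, Pi.smul_apply, Matrix.smul_mulVec,
      dotProduct_smul]

@[simp]
theorem ttMultilinear_apply (X : TTFactors d r) : ttMultilinear d r X = ttTensor X := rfl

end TensorTrain

/-! ### Tensor norm and inner product. -/

section Norms

variable {N : ℕ} {d : Fin N → ℕ}

theorem tinner_self_nonneg (X : Tensor d) : 0 ≤ tinner X X :=
  Finset.sum_nonneg fun _ _ => mul_self_nonneg _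

theorem tnorm_nonneg (X : Tensor d) : 0 ≤ tnorm X := Real.sqrt_nonneg _

theorem tnorm_sq (X : Tensor d) : tnorm X ^ 2 = ∑ s, X s ^ 2 := by
  rw [tnorm, Real.sq_sqrt (tinner_self_nonneg X), tinner]
  simp only [sq]

theorem tnorm_eq_norm (X : Tensor d) : tnorm X = ‖WithLp.toLp 2 X‖ := by
  rw [EuclideanSpace.norm_eq, tnorm, tinner]
  simp [sq]

theorem tnorm_add_le (X Y : Tensor d) : tnorm (X + Y) ≤ tnorm X + tnorm Y := by
  rw [tnorm_eq_norm, tnorm_eq_norm, tnorm_eq_norm, WithLp.toLp_add]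
  exact norm_add_le _ _

theorem tnorm_sum_le {ι : Type*} (t : Finset ι) (f : ι → Tensor d) :
    tnorm (∑ i ∈ t, f i) ≤ ∑ i ∈ t, tnorm (f i) := by
  simp only [tnorm_eq_norm, WithLp.toLp_sum]
  exact norm_sum_le _ _

theorem tnorm_sub_comm (X Y : Tensor d) : tnorm (X - Y) = tnorm (Y - X) := by
  rw [tnorm_eq_norm, tnorm_eq_norm, WithLp.toLp_sub, WithLp.toLp_sub, norm_sub_rev]

theorem tinner_add_right (A X Y : Tensor d) : tinner A (X + Y) = tinner A X + tinner A Y := by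
  simp only [tinner, Pi.add_apply, mul_add, Finset.sum_add_distrib]

theorem tinner_sub_right (A X Y : Tensor d) : tinner A (X - Y) = tinner A X - tinner A Y := by
  simp only [tinner, Pi.sub_apply, mul_sub, Finset.sum_sub_distrib]

theorem tinner_sum_right {ι : Type*} (A : Tensor d) (t : Finset ι) (f : ι → Tensor d) :
    tinner A (∑ i ∈ t, f i) = ∑ i ∈ t, tinner A (f i) := by
  simp only [tinner, Finset.sum_apply, Finset.mul_sum]
  exact Finset.sum_comm

theorem tinner_smul_left (c : ℝ) (A X : Tensor d) : tinner (c • A) X = c * tinner A X := by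
  simp only [tinner, Pi.smul_apply, smul_eq_mul, mul_assoc, Finset.mul_sum]

theorem tinner_sum_left {ι : Type*} (t : Finset ι) (f : ι → Tensor d) (X : Tensor d) :
    tinner (∑ i ∈ t, f i) X = ∑ i ∈ t, tinner (f i) X := by
  simp only [tinner, Finset.sum_apply, Finset.sum_mul]
  exact Finset.sum_comm

end Norms

/-! ### Unfoldings and their factorization into prefix and suffix matrices. -/

section Unfoldings

variable {N : ℕ} {d : Fin N → ℕ}

/-- Multi-indices of the modes before the cut `k`. -/
abbrev LIdx (d : Fin N → ℕ) (k : Fin (N + 1)) : Type :=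
  (j : {j : Fin N // j.castSucc < k}) → Fin (d j.1)

/-- Multi-indices of the modes after the cut `k`. -/
abbrev RIdx (d : Fin N → ℕ) (k : Fin (N + 1)) : Type :=
  (j : {j : Fin N // ¬ j.castSucc < k}) → Fin (d j.1)

/-- The unfolding of a tensor at an arbitrary set of row modes. -/
def unfoldAt (p : Fin N → Prop) [DecidablePred p] (T : Tensor d) :
    Matrix ((j : {j : Fin N // p j}) → Fin (d j.1)) ((j : {j : Fin N // ¬ p j}) → Fin (d j.1)) ℝ :=
  Matrix.of fun a b => T fun j => if h : p j then a ⟨j, h⟩ else b ⟨j, h⟩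

/-- The unfolding of a tensor at the cut `k`. -/
abbrev unfoldCut (k : Fin (N + 1)) (T : Tensor d) : Matrix (LIdx d k) (RIdx d k) ℝ :=
  unfoldAt (fun j : Fin N => j.castSucc < k) T

theorem unfoldAt_sub (p : Fin N → Prop) [DecidablePred p] (T T' : Tensor d) :
    unfoldAt p (T - T') = unfoldAt p T - unfoldAt p T' := rfl

theorem frobSq_unfoldAt (p : Fin N → Prop) [DecidablePred p] (T : Tensor d) :
    frobSq (unfoldAt p T) = tnorm T ^ 2 := by
  rw [tnorm_sq, ← (Equiv.piEquivPiSubtypeProd p fun j => Fin (d j)).symm.sum_comp,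
    Fintype.sum_prod_type]
  rfl

/-- The index types of an unfolding depend on the predicate selecting the row modes; substituting
equal predicates avoids transporting matrices. -/
theorem sing_unfoldAt_congr {p q : Fin N → Prop} [ip : DecidablePred p] [iq : DecidablePred q]
    (h : p = q) (T : Tensor d) (k : ℕ) :
    sing (unfoldAt p T) k = sing (unfoldAt q T) k := by
  subst h
  obtain rfl : ip = iq := Subsingleton.elim _ _
  rfl

theorem rank_unfoldAt_congr {p q : Fin N → Prop} [ip : DecidablePred p] [iq : DecidablePred q]
    (h : p = q) (T : Tensor d) : (unfoldAt p T).rank = (unfoldAt q T).rank := by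
  subst h
  obtain rfl : ip = iq := Subsingleton.elim _ _
  rfl

theorem le_iff_castSucc_lt_succ (i : Fin N) :
    (fun j : Fin N => j ≤ i) = fun j : Fin N => j.castSucc < i.succ := by
  ext j
  rw [Fin.lt_def, Fin.le_def, Fin.val_castSucc, Fin.val_succ, Nat.lt_succ_iff]

theorem sing_unfolding (T : Tensor d) (i : Fin N) (k : ℕ) :
    sing (unfolding T i) k = sing (unfoldCut i.succ T) k :=
  sing_unfoldAt_congr (le_iff_castSucc_lt_succ i) T k

theorem rank_unfolding (T : Tensor d) (i : Fin N) :
    (unfolding T i).rank = (unfoldCut i.succ T).rank :=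
  rank_unfoldAt_congr (le_iff_castSucc_lt_succ i) T

/-- Extend a multi-index of the modes before the cut by the entries of `s₀`. -/
def extendL (s₀ : (i : Fin N) → Fin (d i)) {k : Fin (N + 1)} (a : LIdx d k) :
    (i : Fin N) → Fin (d i) :=
  fun j => if h : j.castSucc < k then a ⟨j, h⟩ else s₀ j

/-- Extend a multi-index of the modes after the cut by the entries of `s₀`. -/
def extendR (s₀ : (i : Fin N) → Fin (d i)) {k : Fin (N + 1)} (b : RIdx d k) :
    (i : Fin N) → Fin (d i) :=
  fun j => if h : j.castSucc < k then s₀ j else b ⟨j, h⟩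

/-- Splitting off the last one of the modes before a cut. -/
def splitLast (s₀ : (i : Fin N) → Fin (d i)) (i : Fin N) :
    LIdx d i.succ ≃ Fin (d i) × LIdx d i.castSucc where
  toFun a := (a ⟨i, Fin.castSucc_lt_succ⟩, fun j => a ⟨j.1, j.2.trans Fin.castSucc_lt_succ⟩)
  invFun ta := fun j => Function.update (extendL s₀ ta.2) i ta.1 j.1
  left_inv a := by
    ext1 ⟨j, hj⟩
    by_cases h : j = i
    · subst h; simp
    · have h' : j.castSucc < i.castSucc := by
        rw [Fin.lt_def] at hj ⊢
        have : j.val ≠ i.val := fun e => h (Fin.ext e)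
        simp at hj ⊢
        omega
      simp only
      rw [Function.update_of_ne h, extendL, dif_pos h']
  right_inv ta := by
    refine Prod.ext (by simp) ?_
    ext1 ⟨j, hj⟩
    have h : j ≠ i := by rintro rfl; exact lt_irrefl _ hj
    simp only
    rw [Function.update_of_ne h, extendL, dif_pos hj]

theorem extendL_splitLast (s₀ : (i : Fin N) → Fin (d i)) (i : Fin N) (a : LIdx d i.succ)
    {j : Fin N} (hj : j.castSucc < i.castSucc) :
    extendL s₀ a j = extendL s₀ (splitLast s₀ i a).2 j := by
  rw [extendL, extendL, dif_pos hj, dif_pos (hj.trans Fin.castSucc_lt_succ)]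
  rfl

theorem extendL_splitLast_self (s₀ : (i : Fin N) → Fin (d i)) (i : Fin N) (a : LIdx d i.succ) :
    extendL s₀ a i = (splitLast s₀ i a).1 := by
  rw [extendL, dif_pos Fin.castSucc_lt_succ]
  rfl

variable {r : TTRanks N}

/-- The matrix with rows `X_1(s_1) ⋯ X_k(s_k)`. -/
def preMat (s₀ : (i : Fin N) → Fin (d i)) (X : TTFactors d r) (k : Fin (N + 1)) :
    Matrix (LIdx d k) (Fin (r k)) ℝ :=
  Matrix.of fun a => preVec X (extendL s₀ a) k

/-- The matrix with columns `X_{k+1}(s_{k+1}) ⋯ X_N(s_N)`. -/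
def sufMat (s₀ : (i : Fin N) → Fin (d i)) (X : TTFactors d r) (k : Fin (N + 1)) :
    Matrix (Fin (r k)) (RIdx d k) ℝ :=
  Matrix.of fun c b => sufVec X (extendR s₀ b) k c

/-- The base index `s₀` only completes partial multi-indices: a prefix reads only modes before the
cut and a suffix only modes after it. -/
theorem unfoldCut_ttTensor (s₀ : (i : Fin N) → Fin (d i)) (X : TTFactors d r)
    (k : Fin (N + 1)) : unfoldCut k (ttTensor X) = preMat s₀ X k * sufMat s₀ X k := by
  ext a b
  simp only [unfoldCut, unfoldAt, Matrix.of_apply]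
  rw [ttTensor_eq_dotProduct _ _ k, Matrix.mul_apply]
  refine Finset.sum_congr rfl fun c _ => ?_
  simp only [preMat, sufMat, Matrix.of_apply]
  rw [preVec_congr (X' := X) (s' := extendL s₀ a), sufVec_congr (X' := X) (s' := extendR s₀ b)]
  · intro j hj
    rw [extendR, dif_neg (not_lt.2 hj), dif_neg (not_lt.2 hj)]
  · intro j hj
    rw [extendL, dif_pos hj, dif_pos hj]

theorem preMat_congr (s₀ : (i : Fin N) → Fin (d i)) {X X' : TTFactors d r} {k : Fin (N + 1)}
    (h : ∀ j : Fin N, j.castSucc < k → X j = X' j) : preMat s₀ X k = preMat s₀ X' k := by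
  ext a c
  simp only [preMat, Matrix.of_apply]
  rw [preVec_congr fun j hj => by rw [h j hj]]

theorem sufMat_congr (s₀ : (i : Fin N) → Fin (d i)) {X X' : TTFactors d r} {k : Fin (N + 1)}
    (h : ∀ j : Fin N, k ≤ j.castSucc → X j = X' j) : sufMat s₀ X k = sufMat s₀ X' k := by
  ext a c
  simp only [sufMat, Matrix.of_apply]
  rw [sufVec_congr fun j hj => by rw [h j hj]]

/-- The recursion for the prefix matrices, in terms of left unfoldings. -/
theorem preMat_succ (s₀ : (i : Fin N) → Fin (d i)) (X : TTFactors d r) (i : Fin N) :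
    preMat s₀ X i.succ = (((1 : Matrix (Fin (d i)) (Fin (d i)) ℝ) ⊗ₖ preMat s₀ X i.castSucc) *
      leftUnfold (X i)).submatrix (splitLast s₀ i) id := by
  ext a b
  rw [preMat, Matrix.of_apply, preVec_succ, Matrix.submatrix_apply, Matrix.mul_apply,
    Fintype.sum_prod_type, Finset.sum_eq_single (splitLast s₀ i a).1]
  · rw [extendL_splitLast_self, Matrix.vecMul, dotProduct]
    refine Finset.sum_congr rfl fun c _ => ?_
    rw [Matrix.kroneckerMap_apply, Matrix.one_apply_eq, one_mul, preMat, Matrix.of_apply,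
      preVec_congr fun j hj => by rw [extendL_splitLast s₀ i a hj]]
    rfl
  · intro t _ ht
    refine Finset.sum_eq_zero fun c _ => ?_
    rw [Matrix.kroneckerMap_apply, Matrix.one_apply_ne ht.symm, zero_mul, zero_mul]
  · simp

end Unfoldings

/-! ### Block-diagonal matrices I ⊗ B. -/

section Kronecker

variable {m n k : Type*} [Fintype m] [Fintype n] [Fintype k]

theorem OpBound.mul {A : Matrix m k ℝ} {B : Matrix k n ℝ} {α β : ℝ} (hA : OpBound A α)
    (hB : OpBound B β) : OpBound (A * B) (α * β) := by
  intro v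
  rw [← Matrix.mulVec_mulVec, mul_pow, mul_assoc]
  exact (hA _).trans (mul_le_mul_of_nonneg_left (hB v) (sq_nonneg _))

theorem OpBound.submatrix_equiv {A : Matrix m n ℝ} {α : ℝ} (hA : OpBound A α) (e : k ≃ m) :
    OpBound (A.submatrix e id) α := by
  intro v
  refine le_trans (le_of_eq ?_) (hA v)
  simp only [dotProduct]
  exact e.sum_comp fun i => (A *ᵥ v) i * (A *ᵥ v) i

theorem frobSq_submatrix_equiv (A : Matrix m n ℝ) (e : k ≃ m) :
    frobSq (A.submatrix e id) = frobSq A :=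
  e.sum_comp fun i => ∑ b, A i b ^ 2

/-- I ⊗ B acts on each block of the vector separately by B. -/
theorem OpBound.one_kronecker [DecidableEq k] {B : Matrix m n ℝ} {α : ℝ} (hB : OpBound B α) :
    OpBound ((1 : Matrix k k ℝ) ⊗ₖ B) α := by
  intro v
  have h : ∀ t a, (((1 : Matrix k k ℝ) ⊗ₖ B) *ᵥ v) (t, a) = (B *ᵥ fun c => v (t, c)) a := by
    intro t a
    rw [Matrix.mulVec, dotProduct, Fintype.sum_prod_type, Finset.sum_eq_single t]
    · simp [Matrix.mulVec, dotProduct]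
    · intro t' _ ht
      simp [Matrix.one_apply_ne ht.symm]
    · simp
  simp only [dotProduct, Fintype.sum_prod_type, h, Finset.mul_sum]
  refine Finset.sum_le_sum fun t _ => ?_
  rw [← Finset.mul_sum]
  exact hB fun c => v (t, c)

omit [Fintype n] in
theorem one_kronecker_isometry [DecidableEq k] [DecidableEq n] {B : Matrix m n ℝ}
    (hB : Bᵀ * B = 1) :
    ((1 : Matrix k k ℝ) ⊗ₖ B)ᵀ * ((1 : Matrix k k ℝ) ⊗ₖ B) = 1 := by
  rw [← Matrix.kroneckerMap_transpose, ← Matrix.mul_kronecker_mul, hB, Matrix.transpose_one,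
    Matrix.mul_one, Matrix.one_kronecker_one]

omit [Fintype m] [Fintype n] [Fintype k] in
theorem one_kronecker_sub [DecidableEq k] (B B' : Matrix m n ℝ) :
    (1 : Matrix k k ℝ) ⊗ₖ (B - B') = (1 : Matrix k k ℝ) ⊗ₖ B - (1 : Matrix k k ℝ) ⊗ₖ B' := by
  ext ⟨a, b⟩ ⟨c, e⟩
  simp [Matrix.kroneckerMap_apply, mul_sub]

end Kronecker

/-! ### Norm bounds for tensor trains and telescoping of factor differences. -/

section Bounds

variable {N : ℕ} {d : Fin N → ℕ} {r : TTRanks N}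

instance uniqueLIdxZero : Unique (LIdx d 0) where
  default j := absurd j.2 (Fin.not_lt_zero _)
  uniq a := by ext1 j; exact absurd j.2 (Fin.not_lt_zero _)

instance uniqueRIdxLast : Unique (RIdx d (Fin.last N)) where
  default j := absurd (Fin.castSucc_lt_last _) j.2
  uniq a := by ext1 j; exact absurd (Fin.castSucc_lt_last _) j.2

theorem eq_of_card_eq_one {n : ℕ} (h : n = 1) (a b : Fin n) : a = b := by
  subst h; exact Subsingleton.elim a b

theorem preMat_zero_isometry (s₀ : (i : Fin N) → Fin (d i)) (X : TTFactors d r) :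
    (preMat s₀ X 0)ᵀ * preMat s₀ X 0 = 1 := by
  ext a b
  obtain rfl := eq_of_card_eq_one r.first a b
  obtain rfl := eq_of_card_eq_one r.first ⟨0, r.pos _⟩ a
  simp [Matrix.mul_apply, preMat, preVec, ttPrefix_zero]

theorem sufMat_last_coisometry (s₀ : (i : Fin N) → Fin (d i)) (X : TTFactors d r) :
    (sufMat s₀ X (Fin.last N))ᵀᵀ * (sufMat s₀ X (Fin.last N))ᵀ = 1 := by
  ext a b
  obtain rfl := eq_of_card_eq_one r.last a b
  obtain rfl := eq_of_card_eq_one r.last ⟨0, r.pos _⟩ a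
  simp [Matrix.mul_apply, sufMat, sufVec, ttSuffix_last]

theorem OpBound.sufMat_last (s₀ : (i : Fin N) → Fin (d i)) (X : TTFactors d r) :
    OpBound (sufMat s₀ X (Fin.last N)) 1 := by
  have := (OpBound.of_isometry (sufMat_last_coisometry s₀ X)).transpose
  rwa [Matrix.transpose_transpose] at this

theorem preMat_isometry (s₀ : (i : Fin N) → Fin (d i)) (X : TTFactors d r) {k : Fin (N + 1)}
    (h : ∀ j : Fin N, j.castSucc < k → (leftUnfold (X j))ᵀ * leftUnfold (X j) = 1) :
    (preMat s₀ X k)ᵀ * preMat s₀ X k = 1 := by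
  induction k using Fin.induction with
  | zero => exact preMat_zero_isometry s₀ X
  | succ i ih =>
    have h1 := one_kronecker_isometry (k := Fin (d i))
      (ih fun j hj => h j (hj.trans Fin.castSucc_lt_succ))
    rw [preMat_succ, Matrix.transpose_submatrix, Matrix.submatrix_mul_equiv,
      Matrix.transpose_mul, Matrix.mul_assoc, ← Matrix.mul_assoc _ _ (leftUnfold (X i)), h1,
      Matrix.one_mul, h i Fin.castSucc_lt_succ, Matrix.submatrix_id_id]

theorem LeftOrthogonal.isometry {X : TTFactors d r} (hX : LeftOrthogonal X) {j : Fin N}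
    (hj : j.val + 1 < N) : (leftUnfold (X j))ᵀ * leftUnfold (X j) = 1 := hX ⟨j, hj⟩

theorem LeftOrthogonal.preMat_isometry (s₀ : (i : Fin N) → Fin (d i)) {X : TTFactors d r}
    (hX : LeftOrthogonal X) {k : Fin (N + 1)} (hk : k ≠ Fin.last N) :
    (preMat s₀ X k)ᵀ * preMat s₀ X k = 1 := by
  refine RobustTT.preMat_isometry s₀ X fun j hj => hX.isometry ?_
  have h1 := Fin.lt_last_iff_ne_last.2 hk
  rw [Fin.lt_def] at hj h1
  simp at hj h1
  omega

/-- Operator norm of prefix matrices that contain one exceptional factor. -/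
theorem OpBound.preMat_of_exceptional (s₀ : (i : Fin N) → Fin (d i)) (X : TTFactors d r)
    (k : Fin (N + 1)) (i : Fin N) {β : ℝ} (hi : OpBound (leftUnfold (X i)) β)
    (h : ∀ j : Fin N, j.castSucc < k → j ≠ i → OpBound (leftUnfold (X j)) 1) :
    OpBound (preMat s₀ X k) (if i.castSucc < k then β else 1) := by
  induction k using Fin.induction with
  | zero => simpa using OpBound.of_isometry (preMat_zero_isometry s₀ X)
  | succ j ih =>
    have ih := ih fun l hl => h l (hl.trans Fin.castSucc_lt_succ)
    rw [preMat_succ]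
    apply OpBound.submatrix_equiv
    by_cases hij : j = i
    · subst hij
      rw [if_neg (lt_irrefl _)] at ih
      rw [if_pos Fin.castSucc_lt_succ, ← one_mul β]
      exact ih.one_kronecker.mul hi
    · have e : i.castSucc < j.succ ↔ i.castSucc < j.castSucc := by
        have : j.val ≠ i.val := fun e => hij (Fin.ext e)
        simp only [Fin.lt_def, Fin.val_castSucc, Fin.val_succ]
        omega
      simp only [e]
      rw [← mul_one (ite _ _ _)]
      exact ih.one_kronecker.mul (h j Fin.castSucc_lt_succ hij)

theorem frobSq_preMat_succ_le {s₀ : (i : Fin N) → Fin (d i)} {X : TTFactors d r} {i : Fin N}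
    {α : ℝ} (h : OpBound (preMat s₀ X i.castSucc) α) :
    frobSq (preMat s₀ X i.succ) ≤ α ^ 2 * frobSq (leftUnfold (X i)) := by
  rw [preMat_succ, frobSq_submatrix_equiv]
  exact h.one_kronecker.frobSq_mul_le _

/-- Unfolded after mode i, the tensor is (I ⊗ prefix)·L(X_i)·suffix up to a reordering of rows. Only
the middle matrix needs its Frobenius norm; the outer two cost operator norms. -/
theorem tnorm_ttTensor_le {s₀ : (i : Fin N) → Fin (d i)} {X : TTFactors d r} {i : Fin N}
    {α β : ℝ} (hα : 0 ≤ α) (hβ : 0 ≤ β) (h : OpBound (preMat s₀ X i.castSucc) α)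
    (h' : OpBound (sufMat s₀ X i.succ) β) :
    tnorm (ttTensor X) ≤ α * β * fnorm (leftUnfold (X i)) := by
  apply le_of_sq_le_sq _ (mul_nonneg (mul_nonneg hα hβ) (fnorm_nonneg _))
  rw [← frobSq_unfoldAt (fun j : Fin N => j.castSucc < i.succ)]
  change frobSq (unfoldCut i.succ (ttTensor X)) ≤ _
  rw [unfoldCut_ttTensor s₀, mul_pow, fnorm_sq]
  refine (h'.frobSq_mul_le' _).trans ?_
  rw [mul_pow, mul_comm (α ^ 2), mul_assoc]
  exact mul_le_mul_of_nonneg_left (frobSq_preMat_succ_le h) (sq_nonneg _)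

/-- The prefix P has orthonormal columns, so the suffix equals Pᵀ times the unfolding and inherits
its operator norm. -/
theorem OpBound.sufMat_of_unfoldCut {s₀ : (i : Fin N) → Fin (d i)} {X : TTFactors d r}
    (hX : LeftOrthogonal X) {k : Fin (N + 1)} (hk : k ≠ Fin.last N) {β : ℝ}
    (h : OpBound (unfoldCut k (ttTensor X)) β) : OpBound (sufMat s₀ X k) β := by
  have hP := hX.preMat_isometry s₀ hk
  have e : sufMat s₀ X k = (preMat s₀ X k)ᵀ * unfoldCut k (ttTensor X) := by
    rw [unfoldCut_ttTensor s₀, ← Matrix.mul_assoc, hP, Matrix.one_mul]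
  rw [e, ← one_mul β]
  exact (OpBound.of_isometry hP).transpose.mul h

theorem succ_ne_last {i : Fin N} (hi : i.val + 1 < N) : i.succ ≠ Fin.last N := by
  intro h
  have := congrArg Fin.val h
  simp at this
  omega

theorem succ_eq_last {i : Fin N} (hi : ¬ i.val + 1 < N) : i.succ = Fin.last N := by
  ext
  simp
  omega

theorem castSucc_ne_last (i : Fin N) : i.castSucc ≠ Fin.last N :=
  (Fin.castSucc_lt_last i).ne

theorem sing_le_sigmaMax (T : Tensor d) {i : Fin N} (hi : i.val + 1 < N) :
    sing (unfolding T i) 1 ≤ sigmaMax T :=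
  le_ciSup (f := fun i : InnerIdx N => sing (unfolding T i.1) 1) (Set.finite_range _).bddAbove
    ⟨i, hi⟩

theorem sigmaMin_le_sing (r : TTRanks N) (T : Tensor d) {i : Fin N} (hi : i.val + 1 < N) :
    sigmaMin r T ≤ sing (unfolding T i) (r i.succ) :=
  ciInf_le (f := fun i : InnerIdx N => sing (unfolding T i.1) (r i.1.succ))
    (Set.finite_range _).bddBelow ⟨i, hi⟩

theorem sigmaMax_nonneg (T : Tensor d) : 0 ≤ sigmaMax T :=
  Real.iSup_nonneg fun _ => sing_nonneg _ _

theorem OpBound.unfoldCut_sigmaMax (T : Tensor d) {i : Fin N} (hi : i.val + 1 < N) :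
    OpBound (unfoldCut i.succ T) (sigmaMax T) := by
  refine (OpBound.sing_one _).mono (sing_nonneg _ _) ?_
  rw [← sing_unfolding]
  exact sing_le_sigmaMax T hi

theorem OpBound.unfoldAt_tnorm (p : Fin N → Prop) [DecidablePred p] (T : Tensor d) :
    OpBound (unfoldAt p T) (tnorm T) :=
  OpBound.of_frobSq_le (frobSq_unfoldAt p T).le

/-- The weight of the `i`-th factor: `σ` for all factors but the last one, whose weight is one. -/
def wt (σ : ℝ) (i : Fin N) : ℝ := if i.val + 1 < N then σ else 1

theorem wt_nonneg {σ : ℝ} (hσ : 0 ≤ σ) (i : Fin N) : 0 ≤ wt σ i := by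
  rw [wt]; split_ifs <;> simp [hσ]

/-- An unfolding of a nearby tensor differs from that of T by a matrix of operator norm at most the
tensor distance. After the last factor the suffix is trivial, whence the weight one. -/
theorem OpBound.sufMat_wt {s₀ : (i : Fin N) → Fin (d i)} {X : TTFactors d r}
    (hX : LeftOrthogonal X) {T : Tensor d} {ε : ℝ} (h : tnorm (ttTensor X - T) ≤ ε) (i : Fin N) :
    OpBound (sufMat s₀ X i.succ) (wt (sigmaMax T + ε) i) := by
  rw [wt]
  split_ifs with hi
  · apply OpBound.sufMat_of_unfoldCut hX (succ_ne_last hi)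
    have e : unfoldCut i.succ (ttTensor X) =
        unfoldCut i.succ T + unfoldCut i.succ (ttTensor X - T) := by
      rw [unfoldCut, unfoldCut, unfoldCut, unfoldAt_sub]; abel
    rw [e]
    exact (OpBound.unfoldCut_sigmaMax T hi).add
      ((OpBound.unfoldAt_tnorm _ _).mono (tnorm_nonneg _) h) (sigmaMax_nonneg T)
      ((tnorm_nonneg _).trans h)
  · rw [succ_eq_last hi]
    exact OpBound.sufMat_last s₀ X

theorem tnorm_zero : tnorm (0 : Tensor d) = 0 := by simp [tnorm, tinner]

theorem OpBound.sufMat_wt_self {s₀ : (i : Fin N) → Fin (d i)} {X : TTFactors d r}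
    (hX : LeftOrthogonal X) (i : Fin N) :
    OpBound (sufMat s₀ X i.succ) (wt (sigmaMax (ttTensor X)) i) := by
  have := OpBound.sufMat_wt (s₀ := s₀) hX (T := ttTensor X) (ε := 0)
    (by rw [sub_self, tnorm_zero]) i
  rwa [add_zero] at this

theorem leftUnfold_sub {e p q : ℕ} (Y Z : Fin e → Matrix (Fin p) (Fin q) ℝ) :
    leftUnfold (Y - Z) = leftUnfold Y - leftUnfold Z := rfl

/-- The norm of a tensor train with left-orthogonal factors, one of which is replaced. -/
theorem tnorm_ttTensor_update_le {s₀ : (i : Fin N) → Fin (d i)} {X : TTFactors d r}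
    (hX : LeftOrthogonal X) {i : Fin N} {β : ℝ} (hβ : 0 ≤ β) (h : OpBound (sufMat s₀ X i.succ) β)
    (H : Fin (d i) → Matrix (Fin (r i.castSucc)) (Fin (r i.succ)) ℝ) :
    tnorm (ttTensor (Function.update X i H)) ≤ β * fnorm (leftUnfold H) := by
  have h1 : OpBound (preMat s₀ (Function.update X i H) i.castSucc) 1 := by
    rw [preMat_congr s₀ (X' := X)]
    · exact OpBound.of_isometry (hX.preMat_isometry s₀ (castSucc_ne_last i))
    · intro j hj
      rw [Function.update_of_ne]
      rintro rfl
      exact lt_irrefl _ hj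
  have h2 : OpBound (sufMat s₀ (Function.update X i H) i.succ) β := by
    rw [sufMat_congr s₀ (X' := X)]
    · exact h
    · intro j hj
      rw [Function.update_of_ne]
      rintro rfl
      exact absurd hj (not_le.2 Fin.castSucc_lt_succ)
  have := tnorm_ttTensor_le zero_le_one hβ h1 h2
  rwa [one_mul, Function.update_self] at this

/-- The factors `X_1, …, X_{i-1}, X_i - Y_i, Y_{i+1}, …, Y_N`. -/
def hybrid (X Y : TTFactors d r) (i : Fin N) : TTFactors d r := fun j =>
  if j < i then X j else if j = i then X j - Y j else Y j

/-- Telescoping: the factors of X are replaced by those of Y one at a time. -/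
theorem ttTensor_sub_eq_sum (X Y : TTFactors d r) :
    ttTensor X - ttTensor Y = ∑ i, ttTensor (hybrid X Y i) := by
  have := (ttMultilinear d r).map_piecewise_sub_map_piecewise X Y X Finset.univ
  simp only [Finset.piecewise_univ, Finset.mem_univ, if_true, ttMultilinear_apply] at this
  exact this

/-- The prefix of a hybrid comes from X and is an isometry; its suffix comes from Y and costs σ̄(Y),
or one at the last factor. These are the weights in the factor distance. -/
theorem tnorm_hybrid_le {s₀ : (i : Fin N) → Fin (d i)} {X Y : TTFactors d r}
    (hX : LeftOrthogonal X) (hY : LeftOrthogonal Y) (i : Fin N) :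
    tnorm (ttTensor (hybrid X Y i)) ≤
      wt (sigmaMax (ttTensor Y)) i * fnorm (leftUnfold (X i) - leftUnfold (Y i)) := by
  have h1 : OpBound (preMat s₀ (hybrid X Y i) i.castSucc) 1 := by
    rw [preMat_congr s₀ (X' := X)]
    · exact OpBound.of_isometry (hX.preMat_isometry s₀ (castSucc_ne_last i))
    · intro j hj
      exact if_pos (Fin.castSucc_lt_castSucc_iff.1 hj)
  have h2 : OpBound (sufMat s₀ (hybrid X Y i) i.succ) (wt (sigmaMax (ttTensor Y)) i) := by
    rw [sufMat_congr s₀ (X' := Y)]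
    · exact OpBound.sufMat_wt_self hY i
    · intro j hj
      have : i < j := Fin.succ_le_castSucc_iff.1 hj
      rw [hybrid, if_neg this.not_gt, if_neg this.ne']
  have := tnorm_ttTensor_le zero_le_one (wt_nonneg (sigmaMax_nonneg _) i) h1 h2
  rw [one_mul] at this
  convert this using 3
  rw [hybrid, if_neg (lt_irrefl _), if_pos rfl, leftUnfold_sub]

theorem tnorm_sub_le_sum {s₀ : (i : Fin N) → Fin (d i)} {X Y : TTFactors d r}
    (hX : LeftOrthogonal X) (hY : LeftOrthogonal Y) :
    tnorm (ttTensor X - ttTensor Y) ≤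
      ∑ i, wt (sigmaMax (ttTensor Y)) i * fnorm (leftUnfold (X i) - leftUnfold (Y i)) := by
  rw [ttTensor_sub_eq_sum]
  exact (tnorm_sum_le _ _).trans
    (Finset.sum_le_sum fun i _ => tnorm_hybrid_le (s₀ := s₀) hX hY i)

/-- The factors `X_1, …, X_i - Y_i, …, X_j - Y_j, Y_{j+1}, …, Y_N` (for `i < j`), all factors that
are not shown being those of `X`. -/
def hybrid₂ (X Y : TTFactors d r) (i j : Fin N) : TTFactors d r := fun l =>
  if l ∈ Finset.Ioi i then (if l < j then X l else if l = j then X l - Y l else Y l)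
  else Function.update X i (X i - Y i) l

/-- A second telescoping, over the factors after i, writes the linearization error as terms
containing two factor differences each. -/
theorem ttTensor_update_sub_hybrid (X Y : TTFactors d r) (i : Fin N) :
    ttTensor (Function.update X i (X i - Y i)) - ttTensor (hybrid X Y i) =
      ∑ j ∈ Finset.Ioi i, ttTensor (hybrid₂ X Y i j) := by
  have := (ttMultilinear d r).map_piecewise_sub_map_piecewise X Y
    (Function.update X i (X i - Y i)) (Finset.Ioi i)
  simp only [ttMultilinear_apply] at this
  refine Eq.trans ?_ this
  congr 2
  · ext1 j
    by_cases h : j ∈ Finset.Ioi i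
    · rw [Finset.piecewise_eq_of_mem _ _ _ h, Function.update_of_ne (Finset.mem_Ioi.1 h).ne']
    · rw [Finset.piecewise_eq_of_notMem _ _ _ h]
  · ext1 j
    by_cases h : j ∈ Finset.Ioi i
    · have h' := Finset.mem_Ioi.1 h
      rw [Finset.piecewise_eq_of_mem _ _ _ h, hybrid, if_neg h'.not_gt, if_neg h'.ne']
    · rw [Finset.piecewise_eq_of_notMem _ _ _ h, hybrid]
      rcases (not_lt.1 fun h' => h (Finset.mem_Ioi.2 h')).lt_or_eq with h' | rfl
      · rw [if_pos h', Function.update_of_ne h'.ne]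
      · rw [if_neg (lt_irrefl _), if_pos rfl, Function.update_self]

theorem tnorm_hybrid₂_le {s₀ : (i : Fin N) → Fin (d i)} {X Y : TTFactors d r}
    (hX : LeftOrthogonal X) (hY : LeftOrthogonal Y) {i j : Fin N} (hij : i < j) :
    tnorm (ttTensor (hybrid₂ X Y i j)) ≤ fnorm (leftUnfold (X i) - leftUnfold (Y i)) *
      (wt (sigmaMax (ttTensor Y)) j * fnorm (leftUnfold (X j) - leftUnfold (Y j))) := by
  have ei : hybrid₂ X Y i j i = X i - Y i := by
    rw [hybrid₂, if_neg (by simp), Function.update_self]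
  have ej : hybrid₂ X Y i j j = X j - Y j := by
    rw [hybrid₂, if_pos (Finset.mem_Ioi.2 hij), if_neg (lt_irrefl _), if_pos rfl]
  -- Of the two differences, the one at j is measured in Frobenius norm; the one at i sits inside
  -- the prefix, where its Frobenius norm serves as an operator bound.
  have h1 : OpBound (preMat s₀ (hybrid₂ X Y i j) j.castSucc)
      (fnorm (leftUnfold (X i) - leftUnfold (Y i))) := by
    have := OpBound.preMat_of_exceptional s₀ (hybrid₂ X Y i j) j.castSucc i
      (β := fnorm (leftUnfold (X i) - leftUnfold (Y i))) ?_ ?_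
    · rwa [if_pos (Fin.castSucc_lt_castSucc_iff.2 hij)] at this
    · rw [ei]
      exact OpBound.of_frobSq_le (fnorm_sq _).ge
    · intro l hl hli
      have hl' : l < j := Fin.castSucc_lt_castSucc_iff.1 hl
      have e : hybrid₂ X Y i j l = X l := by
        rw [hybrid₂, if_pos hl', Function.update_of_ne hli, ite_self]
      rw [e]
      refine OpBound.of_isometry (hX.isometry ?_)
      have := j.2
      rw [Fin.lt_def] at hl'
      omega
  have h2 : OpBound (sufMat s₀ (hybrid₂ X Y i j) j.succ) (wt (sigmaMax (ttTensor Y)) j) := by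
    rw [sufMat_congr s₀ (X' := Y)]
    · exact OpBound.sufMat_wt_self hY j
    · intro l hl
      have : j < l := Fin.succ_le_castSucc_iff.1 hl
      rw [hybrid₂, if_pos (Finset.mem_Ioi.2 (hij.trans this)), if_neg this.not_gt,
        if_neg this.ne']
  have := tnorm_ttTensor_le (fnorm_nonneg _) (wt_nonneg (sigmaMax_nonneg _) j) h1 h2
  rwa [mul_assoc, ej] at this

end Bounds

/-! ### Orthogonal gauge freedom and attainment of the distance. -/

section Rotation

variable {N : ℕ} {d : Fin N → ℕ} {r : TTRanks N}

theorem transpose_mul_self_of_orthogonalGroup {n : ℕ} (R : Matrix.orthogonalGroup (Fin n) ℝ) :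
    (R : Matrix (Fin n) (Fin n) ℝ)ᵀ * (R : Matrix (Fin n) (Fin n) ℝ) = 1 :=
  (Matrix.mem_orthogonalGroup_iff' _ _).1 R.2

theorem mul_transpose_self_of_orthogonalGroup {n : ℕ} (R : Matrix.orthogonalGroup (Fin n) ℝ) :
    (R : Matrix (Fin n) (Fin n) ℝ) * (R : Matrix (Fin n) (Fin n) ℝ)ᵀ = 1 :=
  (Matrix.mem_orthogonalGroup_iff _ _).1 R.2

theorem ttPrefix_rotate (R : Rotations r) (X : TTFactors d r) (s : (i : Fin N) → Fin (d i))
    (k : Fin (N + 1)) :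
    ttPrefix (rotate R X) s k = ttPrefix X s k * (R.1 k : Matrix (Fin (r k)) (Fin (r k)) ℝ) := by
  induction k using Fin.induction with
  | zero => rw [ttPrefix_zero, ttPrefix_zero, R.2.1, Matrix.one_mul]; rfl
  | succ i ih =>
    rw [ttPrefix_succ, ttPrefix_succ, ih, rotate, ← Matrix.mul_assoc, ← Matrix.mul_assoc,
      Matrix.mul_assoc (ttPrefix X s i.castSucc), mul_transpose_self_of_orthogonalGroup,
      Matrix.mul_one]

theorem ttTensor_rotate (R : Rotations r) (X : TTFactors d r) :
    ttTensor (rotate R X) = ttTensor X := by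
  ext s
  rw [ttTensor, ttPrefix_rotate, R.2.2, ttTensor]
  simp

theorem preMat_rotate (s₀ : (i : Fin N) → Fin (d i)) (R : Rotations r) (X : TTFactors d r)
    (k : Fin (N + 1)) :
    preMat s₀ (rotate R X) k = preMat s₀ X k * (R.1 k : Matrix (Fin (r k)) (Fin (r k)) ℝ) := by
  ext a b
  simp only [preMat, Matrix.of_apply, preVec, ttPrefix_rotate]
  rfl

theorem leftUnfold_rotate (R : Rotations r) (X : TTFactors d r) (i : Fin N) :
    leftUnfold (rotate R X i) = ((1 : Matrix (Fin (d i)) (Fin (d i)) ℝ) ⊗ₖ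
      (R.1 i.castSucc : Matrix (Fin (r i.castSucc)) (Fin (r i.castSucc)) ℝ)ᵀ) *
        (leftUnfold (X i) * (R.1 i.succ : Matrix (Fin (r i.succ)) (Fin (r i.succ)) ℝ)) := by
  ext ⟨t, a⟩ b
  rw [leftUnfold, Matrix.of_apply, rotate, Matrix.mul_assoc, Matrix.mul_apply, Matrix.mul_apply,
    Fintype.sum_prod_type, Finset.sum_eq_single t]
  · refine Finset.sum_congr rfl fun c _ => ?_
    rw [Matrix.kroneckerMap_apply, Matrix.one_apply_eq, one_mul]
    rfl
  · intro t' _ ht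
    refine Finset.sum_eq_zero fun c _ => ?_
    rw [Matrix.kroneckerMap_apply, Matrix.one_apply_ne ht.symm, zero_mul, zero_mul]
  · simp

theorem LeftOrthogonal.rotate {X : TTFactors d r} (hX : LeftOrthogonal X) (R : Rotations r) :
    LeftOrthogonal (rotate R X) := by
  intro i
  have h := one_kronecker_isometry (k := Fin (d i.1))
    (B := (R.1 i.1.castSucc : Matrix (Fin (r i.1.castSucc)) (Fin (r i.1.castSucc)) ℝ)ᵀ)
    (by rw [Matrix.transpose_transpose, mul_transpose_self_of_orthogonalGroup])
  rw [leftUnfold_rotate, Matrix.transpose_mul, Matrix.mul_assoc, ← Matrix.mul_assoc _ _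
    (leftUnfold (X i.1) * _), h, Matrix.one_mul, Matrix.transpose_mul, Matrix.mul_assoc,
    ← Matrix.mul_assoc _ (leftUnfold (X i.1)), hX i, Matrix.one_mul,
    transpose_mul_self_of_orthogonalGroup]

/-- Compactness makes the infimum over rotations a minimum. -/
instance compactSpace_orthogonalGroup (n : ℕ) : CompactSpace (Matrix.orthogonalGroup (Fin n) ℝ) := by
  apply (isCompact_iff_compactSpace (s := {A | A ∈ Matrix.orthogonalGroup (Fin n) ℝ})).1
  have hc : IsCompact (Set.univ.pi fun _ => Set.univ.pi fun _ => Set.Icc (-1) 1 :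
      Set (Fin n → Fin n → ℝ)) :=
    isCompact_univ_pi fun _ => isCompact_univ_pi fun _ => isCompact_Icc
  refine hc.of_isClosed_subset ?_ ?_
  · have e : {A | A ∈ Matrix.orthogonalGroup (Fin n) ℝ} =
        {A : Matrix (Fin n) (Fin n) ℝ | A * Aᵀ = 1} := by
      ext A; exact Matrix.mem_orthogonalGroup_iff _ _
    rw [e]
    exact isClosed_eq (by fun_prop) continuous_const
  · intro A hA a _ b _
    exact abs_le.1 (entry_norm_bound_of_unitary (𝕜 := ℝ) hA a b)

instance compactSpace_rotations (r : TTRanks N) : CompactSpace (Rotations r) := by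
  apply (isCompact_iff_compactSpace
    (s := {R : (k : Fin (N + 1)) → Matrix.orthogonalGroup (Fin (r k)) ℝ |
      R 0 = 1 ∧ R (Fin.last N) = 1})).1
  apply IsClosed.isCompact
  exact (isClosed_eq (continuous_apply 0) continuous_const).inter
    (isClosed_eq (continuous_apply (Fin.last N)) continuous_const)

instance nonempty_rotations (r : TTRanks N) : Nonempty (Rotations r) := ⟨⟨1, rfl, rfl⟩⟩

/-- The weighted squared distance of two families of factors. -/
def weightedDistSq (σ : ℝ) (X Y : TTFactors d r) : ℝ :=
  ∑ i, wt σ i ^ 2 * frobSq (leftUnfold (X i) - leftUnfold (Y i))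

theorem weightedDistSq_nonneg (σ : ℝ) (X Y : TTFactors d r) : 0 ≤ weightedDistSq σ X Y :=
  Finset.sum_nonneg fun _ _ => mul_nonneg (sq_nonneg _) (frobSq_nonneg _)

theorem distSq_eq_iInf (X Xs : TTFactors d r) :
    distSq X Xs = ⨅ R : Rotations r, weightedDistSq (sigmaMax (ttTensor Xs)) X (rotate R Xs) := by
  simp only [distSq, weightedDistSq, wt, ite_pow, one_pow]

theorem distSq_le (X Xs : TTFactors d r) (R : Rotations r) :
    distSq X Xs ≤ weightedDistSq (sigmaMax (ttTensor Xs)) X (rotate R Xs) := by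
  rw [distSq_eq_iInf]
  exact ciInf_le ⟨0, by rintro _ ⟨R, rfl⟩; exact weightedDistSq_nonneg _ _ _⟩ R

theorem distSq_nonneg (X Xs : TTFactors d r) : 0 ≤ distSq X Xs := by
  rw [distSq_eq_iInf]
  exact Real.iInf_nonneg fun R => weightedDistSq_nonneg _ _ _

theorem continuous_weightedDistSq_rotate (σ : ℝ) (X Xs : TTFactors d r) :
    Continuous fun R : Rotations r => weightedDistSq σ X (rotate R Xs) := by
  have h : ∀ k, Continuous fun R : Rotations r => (R.1 k : Matrix (Fin (r k)) (Fin (r k)) ℝ) :=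
    fun k => continuous_subtype_val.comp ((continuous_apply k).comp continuous_subtype_val)
  simp only [weightedDistSq, frobSq]
  refine continuous_finsetSum _ fun i _ => continuous_const.mul <|
    continuous_finsetSum _ fun a _ => continuous_finsetSum _ fun b _ => Continuous.pow ?_ 2
  refine continuous_const.sub ?_
  have : Continuous fun R : Rotations r => rotate R Xs i a.1 :=
    (((h i.castSucc).matrix_transpose).matrix_mul continuous_const).matrix_mul (h i.succ)
  exact this.matrix_elem a.2 b

/-- An actual minimizer is needed: the same aligned factors must measure the distance before and
after a step. -/
theorem exists_distSq_eq (X Xs : TTFactors d r) :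
    ∃ R : Rotations r, distSq X Xs = weightedDistSq (sigmaMax (ttTensor Xs)) X (rotate R Xs) := by
  obtain ⟨R, -, hR⟩ := isCompact_univ.exists_isMinOn Set.univ_nonempty
    (continuous_weightedDistSq_rotate (sigmaMax (ttTensor Xs)) X Xs).continuousOn
  refine ⟨R, le_antisymm (distSq_le X Xs R) ?_⟩
  rw [distSq_eq_iInf]
  exact le_ciInf fun R' => hR (Set.mem_univ R')

end Rotation

/-! ### Factor distance controlled by tensor distance. -/

section LowerBound

variable {N : ℕ} {d : Fin N → ℕ} {r : TTRanks N}

theorem frobSq_sub_proj_le {m n k : Type*} [Fintype m] [Fintype n] [Fintype k] [DecidableEq k]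
    {P : Matrix m k ℝ} (hP : Pᵀ * P = 1) (E : Matrix m n ℝ) :
    frobSq (E - P * (Pᵀ * E)) ≤ frobSq E := by
  have h : fip E (P * (Pᵀ * E)) = frobSq (Pᵀ * E) := by
    rw [fip_comm, fip_mul_left, fip_self]
  rw [frobSq_sub, h, frobSq_mul_of_isometry hP]
  linarith [frobSq_nonneg (Pᵀ * E)]

theorem frobSq_of_isometry {m : Type*} [Fintype m] {k : ℕ} {P : Matrix m (Fin k) ℝ}
    (hP : Pᵀ * P = 1) : frobSq P = k := by
  rw [← fip_self, fip_eq_trace, hP, Matrix.trace_one, Fintype.card_fin]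

/-- The column spaces of the unfoldings of two close tensors are close, in terms of aligned
orthonormal bases. -/
theorem exists_rotation_preMat (s₀ : (i : Fin N) → Fin (d i)) {X Xs : TTFactors d r}
    (hX : LeftOrthogonal X) (hXs : LeftOrthogonal Xs) {σ ε : ℝ}
    (hrank : ∀ i : Fin N, i.val + 1 < N → (unfolding (ttTensor Xs) i).rank = r i.succ)
    (hσ : ∀ i : Fin N, i.val + 1 < N → σ ≤ sing (unfolding (ttTensor Xs) i) (r i.succ))
    (hε : tnorm (ttTensor X - ttTensor Xs) ≤ ε) (hεσ : ε < σ) :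
    ∃ R : Rotations r, ∀ k, k ≠ Fin.last N →
      frobSq (preMat s₀ X k - preMat s₀ (rotate R Xs) k) ≤ 2 * (ε / σ) ^ 2 := by
  have hε0 : 0 ≤ ε := (tnorm_nonneg _).trans hε
  have hσ0 : 0 < σ := hε0.trans_lt hεσ
  -- The cuts can be aligned independently of one another; at the two boundary cuts the rotation is
  -- forced to be 1.
  have key : ∀ k : Fin (N + 1), ∃ R : Matrix.orthogonalGroup (Fin (r k)) ℝ,
      (k = 0 ∨ k = Fin.last N → R = 1) ∧ (k ≠ Fin.last N →
        frobSq (preMat s₀ X k - preMat s₀ Xs k * (R : Matrix (Fin (r k)) (Fin (r k)) ℝ)) ≤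
          2 * (ε / σ) ^ 2) := by
    intro k
    by_cases hl : k = Fin.last N
    · exact ⟨1, fun _ => rfl, fun h => absurd hl h⟩
    by_cases h0 : k = 0
    · subst h0
      refine ⟨1, fun _ => rfl, fun _ => ?_⟩
      have e : preMat s₀ X 0 = preMat s₀ Xs 0 := by
        ext a b; rfl
      rw [e]
      simp only [OneMemClass.coe_one, Matrix.mul_one, sub_self]
      refine le_trans (le_of_eq ?_) (by positivity : (0 : ℝ) ≤ 2 * (ε / σ) ^ 2)
      simp [frobSq]
    · obtain ⟨i, rfl⟩ := Fin.exists_succ_eq.2 h0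
      have hi : i.val + 1 < N := by
        have := Fin.lt_last_iff_ne_last.2 hl
        rw [Fin.lt_def] at this
        simpa using this
      have hP := hX.preMat_isometry s₀ hl
      have hP' := hXs.preMat_isometry s₀ hl
      have hT := unfoldCut_ttTensor s₀ X i.succ
      have hT' := unfoldCut_ttTensor s₀ Xs i.succ
      set P := preMat s₀ X i.succ
      set P' := preMat s₀ Xs i.succ
      set Q := sufMat s₀ X i.succ
      set Q' := sufMat s₀ Xs i.succ
      have hsin : σ ^ 2 * frobSq (P' - P * (Pᵀ * P')) ≤ ε ^ 2 := by
        have hr : (P' * Q').rank = r i.succ := by rw [← hT', ← rank_unfolding, hrank i hi]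
        have h1 := sing_rank_mul_frobSq_le hP' hr (P' - P * (Pᵀ * P'))
        have h2 : σ ≤ sing (P' * Q') (r i.succ) := by
          rw [← hT', ← sing_unfolding]; exact hσ i hi
        -- I - P Pᵀ annihilates P Q, so it may act on the difference of the unfoldings, of norm at
        -- most ε. Since Q' stretches by at least σ, the sine of the column spaces is at most ε/σ.
        have h3 : (P' - P * (Pᵀ * P')) * Q' =
            (P' * Q' - P * Q) - P * (Pᵀ * (P' * Q' - P * Q)) := by
          rw [Matrix.sub_mul, Matrix.mul_sub, Matrix.mul_sub, ← Matrix.mul_assoc Pᵀ P Q, hP,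
            Matrix.one_mul]
          simp only [Matrix.mul_assoc]
          abel
        have h4 : frobSq (P' * Q' - P * Q) ≤ ε ^ 2 := by
          rw [← hT, ← hT', unfoldCut, unfoldCut, ← unfoldAt_sub, frobSq_unfoldAt, tnorm_sub_comm]
          exact pow_le_pow_left₀ (tnorm_nonneg _) hε 2
        rw [h3] at h1
        refine le_trans (mul_le_mul_of_nonneg_right (pow_le_pow_left₀ hσ0.le h2 2)
          (frobSq_nonneg _)) (h1.trans ((frobSq_sub_proj_le hP _).trans h4))
      have hsin' : frobSq (P' - P * (Pᵀ * P')) ≤ (ε / σ) ^ 2 := by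
        rw [div_pow, le_div_iff₀ (by positivity), mul_comm]; exact hsin
      have hlt : (ε / σ) ^ 2 < 1 := by
        rw [sq_lt_one_iff₀ (by positivity), div_lt_one hσ0]; exact hεσ
      obtain ⟨R, hR, hR2⟩ := exists_orthogonal_frobSq_sub_le hP hP' (hsin'.trans_lt hlt)
      refine ⟨⟨R, (Matrix.mem_orthogonalGroup_iff' _ _).2 hR⟩,
        fun h => absurd h (not_or.2 ⟨h0, hl⟩), fun _ => hR2.trans ?_⟩
      linarith
  choose R hR1 hR2 using key
  refine ⟨⟨R, hR1 0 (Or.inl rfl), hR1 _ (Or.inr rfl)⟩, fun k hk => ?_⟩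
  rw [preMat_rotate]
  exact hR2 k hk

/-- The factors are controlled by the prefix matrices. -/
theorem fnorm_leftUnfold_sub_le (s₀ : (i : Fin N) → Fin (d i)) {X Y : TTFactors d r}
    (hX : LeftOrthogonal X) (hY : LeftOrthogonal Y) {i : Fin N} (hi : i.val + 1 < N) :
    fnorm (leftUnfold (X i) - leftUnfold (Y i)) ≤ fnorm (preMat s₀ X i.succ - preMat s₀ Y i.succ) +
      fnorm (preMat s₀ X i.castSucc - preMat s₀ Y i.castSucc) * √(r i.succ) := by
  have hP := one_kronecker_isometry (k := Fin (d i))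
    (hX.preMat_isometry s₀ (castSucc_ne_last i))
  have e1 : fnorm (preMat s₀ X i.succ - preMat s₀ Y i.succ) =
      fnorm ((1 : Matrix (Fin (d i)) (Fin (d i)) ℝ) ⊗ₖ preMat s₀ X i.castSucc *
        leftUnfold (X i) - (1 : Matrix (Fin (d i)) (Fin (d i)) ℝ) ⊗ₖ preMat s₀ Y i.castSucc *
        leftUnfold (Y i)) := by
    rw [preMat_succ, preMat_succ, fnorm, fnorm, ← frobSq_submatrix_equiv _ (splitLast s₀ i)]
    rfl
  have e2 : fnorm (leftUnfold (X i) - leftUnfold (Y i)) =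
      fnorm ((1 : Matrix (Fin (d i)) (Fin (d i)) ℝ) ⊗ₖ preMat s₀ X i.castSucc *
        (leftUnfold (X i) - leftUnfold (Y i))) := by
    rw [fnorm, fnorm, frobSq_mul_of_isometry hP]
  -- The new prefix error minus the error inherited from the previous prefix; the latter multiplies
  -- L(Y_i), whose Frobenius norm is √r_i.
  have e3 : (1 : Matrix (Fin (d i)) (Fin (d i)) ℝ) ⊗ₖ preMat s₀ X i.castSucc *
        (leftUnfold (X i) - leftUnfold (Y i)) =
      ((1 : Matrix (Fin (d i)) (Fin (d i)) ℝ) ⊗ₖ preMat s₀ X i.castSucc *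
        leftUnfold (X i) - (1 : Matrix (Fin (d i)) (Fin (d i)) ℝ) ⊗ₖ preMat s₀ Y i.castSucc *
        leftUnfold (Y i)) - (1 : Matrix (Fin (d i)) (Fin (d i)) ℝ) ⊗ₖ
          (preMat s₀ X i.castSucc - preMat s₀ Y i.castSucc) * leftUnfold (Y i) := by
    rw [one_kronecker_sub, Matrix.sub_mul, Matrix.mul_sub]; abel
  rw [e2, e3, e1]
  refine (fnorm_sub_le _ _).trans (add_le_add_right ?_ _)
  apply Real.sqrt_le_iff.2 ⟨mul_nonneg (fnorm_nonneg _) (Real.sqrt_nonneg _), ?_⟩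
  rw [mul_pow, Real.sq_sqrt (Nat.cast_nonneg _), ← frobSq_of_isometry (hY.isometry hi)]
  exact (OpBound.of_frobSq_le (fnorm_sq _).ge).one_kronecker.frobSq_mul_le _

/-- The last factor is controlled by the tensor and the last prefix matrix. -/
theorem fnorm_leftUnfold_last_sub_le (s₀ : (i : Fin N) → Fin (d i)) {X Y : TTFactors d r}
    (hX : LeftOrthogonal X) (hY : LeftOrthogonal Y) {i : Fin N} (hi : ¬ i.val + 1 < N)
    (h0 : i.val ≠ 0) :
    fnorm (leftUnfold (X i) - leftUnfold (Y i)) ≤ tnorm (ttTensor X - ttTensor Y) +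
      fnorm (preMat s₀ X i.castSucc - preMat s₀ Y i.castSucc) * sigmaMax (ttTensor Y) := by
  -- Z has the prefix of X and the last factor of Y. Its difference from X has the norm of the last
  -- factor difference, and its difference from Y is a prefix error times a common suffix.
  set Z : TTFactors d r := Function.update X i (Y i) with hZ
  set W : TTFactors d r := Function.update X i (X i - Y i) with hW
  have hcast : ∀ (H : Fin (d i) → Matrix (Fin (r i.castSucc)) (Fin (r i.succ)) ℝ),
      preMat s₀ (Function.update X i H) i.castSucc = preMat s₀ X i.castSucc := by
    intro H
    refine preMat_congr s₀ fun j hj => ?_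
    rw [Function.update_of_ne]
    rintro rfl
    exact lt_irrefl _ hj
  have e1 : ttTensor W = ttTensor X - ttTensor Z := by
    have := (ttMultilinear d r).map_update_sub X i (X i) (Y i)
    simpa only [ttMultilinear_apply, Function.update_eq_self] using this
  have h1 : fnorm (leftUnfold (X i) - leftUnfold (Y i)) = tnorm (ttTensor W) := by
    have hlast := succ_eq_last hi
    have e : frobSq (preMat s₀ W i.succ) = frobSq (leftUnfold (X i) - leftUnfold (Y i)) := by
      rw [preMat_succ, frobSq_submatrix_equiv, hcast, frobSq_mul_of_isometry
        (one_kronecker_isometry (hX.preMat_isometry s₀ (castSucc_ne_last i))), hW,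
        Function.update_self, leftUnfold_sub]
    have e' : tnorm (ttTensor W) ^ 2 = frobSq (preMat s₀ W i.succ) := by
      rw [← frobSq_unfoldAt (fun j : Fin N => j.castSucc < i.succ)]
      change frobSq (unfoldCut i.succ (ttTensor W)) = _
      rw [unfoldCut_ttTensor s₀, hlast, ← frobSq_transpose, Matrix.transpose_mul,
        frobSq_mul_of_isometry (sufMat_last_coisometry s₀ W), frobSq_transpose]
    rw [fnorm, ← e, ← e', Real.sqrt_sq (tnorm_nonneg _)]
  have h2 : tnorm (ttTensor Z - ttTensor Y) ≤
      fnorm (preMat s₀ X i.castSucc - preMat s₀ Y i.castSucc) * sigmaMax (ttTensor Y) := by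
    -- The suffix at the last inner cut is bounded through the factor just before the last one,
    -- which exists because i is not the first factor.
    obtain ⟨j, hj⟩ : ∃ j : Fin N, j.succ = i.castSucc := by
      refine ⟨⟨i.val - 1, by omega⟩, ?_⟩
      ext
      simp
      omega
    have hj' : j.val + 1 < N := by
      have := congrArg Fin.val hj
      simp at this
      omega
    have hQ : OpBound (sufMat s₀ Y i.castSucc) (sigmaMax (ttTensor Y)) := by
      have := OpBound.sufMat_wt_self (s₀ := s₀) hY j
      rwa [wt, if_pos hj', hj] at this
    apply le_of_sq_le_sq _ (mul_nonneg (fnorm_nonneg _) (sigmaMax_nonneg _))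
    rw [← frobSq_unfoldAt (fun j : Fin N => j.castSucc < i.castSucc), unfoldAt_sub]
    change frobSq (unfoldCut i.castSucc (ttTensor Z) - unfoldCut i.castSucc (ttTensor Y)) ≤ _
    have e2 : sufMat s₀ Z i.castSucc = sufMat s₀ Y i.castSucc := by
      refine sufMat_congr s₀ fun l hl => ?_
      have : l = i := by
        have h3 := Fin.castSucc_le_castSucc_iff.1 hl
        rw [Fin.le_def] at h3
        ext
        have := l.2
        omega
      subst this
      rw [hZ, Function.update_self]
    rw [unfoldCut_ttTensor s₀, unfoldCut_ttTensor s₀, e2, hcast, ← Matrix.sub_mul, mul_pow,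
      fnorm_sq, mul_comm (frobSq _)]
    exact hQ.frobSq_mul_le' _
  have e3 : ttTensor X - ttTensor Z = (ttTensor X - ttTensor Y) + (ttTensor Y - ttTensor Z) := by
    abel
  rw [h1, e1, e3]
  refine (tnorm_add_le _ _).trans (add_le_add_right ?_ _)
  rw [tnorm_sub_comm]
  exact h2

theorem sum_innerIdx_filter (f : Fin N → ℝ) :
    ∑ i : InnerIdx N with 1 ≤ i.1.val, f i.1 =
      ∑ i : Fin N, if i.val + 1 < N ∧ 1 ≤ i.val then f i else 0 := by
  rw [Finset.sum_filter, ← Finset.sum_subtype (Finset.univ.filter fun i : Fin N => i.val + 1 < N)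
    (by simp) fun i : Fin N => if 1 ≤ i.val then f i else 0, Finset.sum_filter]
  simp only [ite_and]

theorem sigmaMin_le_sigmaMax (hN : 2 ≤ N) (r : TTRanks N) (T : Tensor d) :
    sigmaMin r T ≤ sigmaMax T := by
  have h0 : (0 : ℕ) + 1 < N := by omega
  exact (sigmaMin_le_sing r T (i := ⟨0, by omega⟩) h0).trans
    ((sing_antitone _ (r.pos _)).trans (sing_le_sigmaMax T (i := ⟨0, by omega⟩) h0))

/-- The distance of the factors is controlled by the distance of the tensors. -/
theorem distSq_le_mul_tnorm_sq (s₀ : (i : Fin N) → Fin (d i)) (hN : 2 ≤ N) {X Xs : TTFactors d r}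
    (hX : LeftOrthogonal X) (hXs : LeftOrthogonal Xs)
    (hrank : ∀ i : Fin N, i.val + 1 < N → (unfolding (ttTensor Xs) i).rank = r i.succ)
    (hε : tnorm (ttTensor X - ttTensor Xs) < sigmaMin r (ttTensor Xs))
    {S : ℝ} (hS : S = N + 1 + ∑ i : InnerIdx N with 1 ≤ i.1.val, (r i.1.succ : ℝ)) :
    distSq X Xs ≤
      8 * S * condNum r (ttTensor Xs) ^ 2 * tnorm (ttTensor X - ttTensor Xs) ^ 2 := by
  set ε := tnorm (ttTensor X - ttTensor Xs) with hεdef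
  set σ := sigmaMin r (ttTensor Xs) with hσdef
  set τ := sigmaMax (ttTensor Xs) with hτdef
  have hε0 : 0 ≤ ε := tnorm_nonneg _
  have hσ0 : 0 < σ := hε0.trans_lt hε
  have hστ : σ ≤ τ := sigmaMin_le_sigmaMax hN r _
  have hτ0 : 0 < τ := hσ0.trans_le hστ
  obtain ⟨R, hR⟩ := exists_rotation_preMat s₀ hX hXs hrank
    (fun i hi => sigmaMin_le_sing r (ttTensor Xs) hi) le_rfl hε
  have hY := hXs.rotate R
  have hT : ttTensor (rotate R Xs) = ttTensor Xs := ttTensor_rotate R Xs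
  refine (distSq_le X Xs R).trans ?_
  set Y := rotate R Xs with hYdef
  rw [condNum, ← hσdef, ← hτdef, weightedDistSq]
  have hR' : ∀ k, k ≠ Fin.last N → fnorm (preMat s₀ X k - preMat s₀ Y k) ^ 2 ≤ 2 * (ε / σ) ^ 2 :=
    fun k hk => by rw [fnorm_sq]; exact hR k hk
  -- Squared prefix errors are at most 2(ε/σ)², so (x + y)² ≤ 2x² + 2y² bounds the terms, in units
  -- of τ²(ε/σ)², by 4 + 4r_i for inner factors, by 4 for the first, whose preceding prefix is
  -- exact, and by 6 for the last, where ε ≤ τε/σ. Rounding up to 8 + 8r_i and 8 gives a sum of at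
  -- most 8S.
  have hterm : ∀ i : Fin N, wt τ i ^ 2 * frobSq (leftUnfold (X i) - leftUnfold (Y i)) ≤
      (8 + (if i.val + 1 < N ∧ 1 ≤ i.val then 8 * (r i.succ : ℝ) else 0)) *
        ((τ / σ) ^ 2 * ε ^ 2) := by
    intro i
    have ee : (τ / σ) ^ 2 * ε ^ 2 = τ ^ 2 * (ε / σ) ^ 2 := by rw [div_pow, div_pow]; ring
    have hc := hR' _ (castSucc_ne_last i)
    set A := fnorm (preMat s₀ X i.castSucc - preMat s₀ Y i.castSucc) with hA
    have hA0 : 0 ≤ A := fnorm_nonneg _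
    by_cases hi : i.val + 1 < N
    · have h1 := fnorm_leftUnfold_sub_le s₀ hX hY hi
      have hs := hR' _ (succ_ne_last hi)
      rw [← hA] at h1
      set B := fnorm (preMat s₀ X i.succ - preMat s₀ Y i.succ) with hB
      have hB0 : 0 ≤ B := fnorm_nonneg _
      rw [wt, if_pos hi, ee, ← fnorm_sq, mul_left_comm]
      refine mul_le_mul_of_nonneg_left ?_ (sq_nonneg _)
      have hr0 : (0 : ℝ) ≤ r i.succ := Nat.cast_nonneg _
      have hsq := Real.sq_sqrt hr0
      set ρ := √(r i.succ : ℝ) with hρ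
      have hρ0 : 0 ≤ ρ := Real.sqrt_nonneg _
      have h2 := pow_le_pow_left₀ (fnorm_nonneg _) h1 2
      have h3 : (B + A * ρ) ^ 2 ≤ 2 * B ^ 2 + 2 * A ^ 2 * ρ ^ 2 := by
        nlinarith [sq_nonneg (B - A * ρ)]
      by_cases h0 : 1 ≤ i.val
      · rw [if_pos ⟨hi, h0⟩]
        rw [hsq] at h3
        have := mul_le_mul_of_nonneg_right hc hr0
        nlinarith [sq_nonneg (ε / σ)]
      · rw [if_neg (fun h => h0 h.2)]
        have hA00 : A = 0 := by
          have e0 : i.castSucc = 0 := by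
            ext
            simp
            omega
          rw [hA, e0, show preMat s₀ X 0 = preMat s₀ Y 0 by ext a b; rfl, sub_self]
          simp [fnorm, frobSq]
        rw [hA00] at h2 h3
        linarith [h2.trans h3, sq_nonneg (ε / σ)]
    · have h1 := fnorm_leftUnfold_last_sub_le s₀ hX hY hi (by omega)
      rw [hT, ← hεdef, ← hτdef] at h1
      rw [wt, if_neg hi, if_neg (fun h => hi h.1), ee, one_pow, one_mul, add_zero, ← fnorm_sq]
      refine (pow_le_pow_left₀ (fnorm_nonneg _) h1 2).trans ?_
      have h3 : ε ≤ τ * (ε / σ) := by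
        rw [mul_div_assoc', le_div_iff₀ hσ0, mul_comm]
        exact mul_le_mul_of_nonneg_right hστ hε0
      have h4 : ε ^ 2 ≤ τ ^ 2 * (ε / σ) ^ 2 := by
        rw [← mul_pow]; exact pow_le_pow_left₀ hε0 h3 2
      have h5 : (ε + A * τ) ^ 2 ≤ 2 * ε ^ 2 + 2 * (τ ^ 2 * A ^ 2) := by
        nlinarith [sq_nonneg (ε - A * τ)]
      have h6 := mul_le_mul_of_nonneg_left hc (sq_nonneg τ)
      nlinarith
  refine (Finset.sum_le_sum fun i _ => hterm i).trans ?_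
  rw [← Finset.sum_mul, Finset.sum_add_distrib, ← sum_innerIdx_filter fun i => 8 * (r i.succ : ℝ),
    ← Finset.mul_sum, hS, mul_assoc (8 * _)]
  refine mul_le_mul_of_nonneg_right ?_ (by positivity)
  simp
  linarith

end LowerBound

/-! ### Subgradient estimates and the one-step inequality. -/

section Subgradient

variable {N m : ℕ} {d : Fin N → ℕ} {r : TTRanks N}

/-- The subgradient of `T ↦ (1/m) ∑ |⟨𝒜_k, T⟩ - y_k|`. -/
noncomputable def tensorSubgrad (A : Fin m → Tensor d) (y : Fin m → ℝ) (T : Tensor d) : Tensor d :=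
  (1 / m : ℝ) • ∑ k, Real.sign (tinner (A k) T - y k) • A k

theorem tinner_tensorSubgrad (A : Fin m → Tensor d) (y : Fin m → ℝ) (T Z : Tensor d) :
    tinner (tensorSubgrad A y T) Z =
      (1 / m : ℝ) * ∑ k, Real.sign (tinner (A k) T - y k) * tinner (A k) Z := by
  rw [tensorSubgrad, tinner_smul_left, tinner_sum_left]
  simp only [tinner_smul_left]

theorem abs_sign_le_one (x : ℝ) : |Real.sign x| ≤ 1 := by
  rcases Real.sign_apply_eq x with h | h | h <;> simp [h]

theorem abs_tinner_tensorSubgrad_le (A : Fin m → Tensor d) (y : Fin m → ℝ) (T Z : Tensor d) :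
    |tinner (tensorSubgrad A y T) Z| ≤ (1 / m) * ∑ k, |tinner (A k) Z| := by
  rw [tinner_tensorSubgrad, abs_mul, abs_of_nonneg (by positivity : (0 : ℝ) ≤ 1 / m)]
  refine mul_le_mul_of_nonneg_left ((Finset.abs_sum_le_sum_abs _ _).trans
    (Finset.sum_le_sum fun k _ => ?_)) (by positivity)
  rw [abs_mul]
  exact mul_le_of_le_one_left (abs_nonneg _) (abs_sign_le_one _)

/-- The subgradient inequality of the absolute value at u, compared with the point -s; the choice
sign(0) = 0 is a valid subgradient. -/
theorem sign_mul_add_ge (u s : ℝ) : |u| - |s| ≤ Real.sign u * (u + s) := by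
  have h1 : Real.sign u * u = |u| := by
    rcases lt_trichotomy u 0 with h | h | h
    · rw [Real.sign_of_neg h, abs_of_neg h]; ring
    · simp [h]
    · rw [Real.sign_of_pos h, abs_of_pos h]; ring
  have h2 : |Real.sign u * s| ≤ |s| := by
    rw [abs_mul]; exact mul_le_of_le_one_left (abs_nonneg _) (abs_sign_le_one _)
  rw [mul_add, h1]
  linarith [neg_le_of_abs_le h2]

/-- Convexity turns the function-value gap in the sharpness property into correlation of the
subgradient with the error. -/
theorem le_tinner_tensorSubgrad_sub (A : Fin m → Tensor d) (s y : Fin m → ℝ) (T Ts : Tensor d)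
    (hy : ∀ k, y k = tinner (A k) Ts + s k) :
    (1 / m) * ∑ k, |tinner (A k) (T - Ts) - s k| - (1 / m) * ∑ k, |s k| ≤
      tinner (tensorSubgrad A y T) (T - Ts) := by
  rw [tinner_tensorSubgrad, ← mul_sub, ← Finset.sum_sub_distrib]
  refine mul_le_mul_of_nonneg_left (Finset.sum_le_sum fun k _ => ?_) (by positivity)
  have := sign_mul_add_ge (tinner (A k) (T - Ts) - s k) (s k)
  rw [sub_add_cancel] at this
  rwa [show tinner (A k) T - y k = tinner (A k) (T - Ts) - s k by
    rw [hy k, tinner_sub_right]; ring]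

theorem fip_leftUnfold {e p q : ℕ} (B H : Fin e → Matrix (Fin p) (Fin q) ℝ) :
    fip (leftUnfold B) (leftUnfold H) = ∑ t, fip (B t) (H t) := by
  rw [fip, Fintype.sum_prod_type]
  rfl

theorem fip_sum_left {ι m n : Type*} [Fintype m] [Fintype n] (t : Finset ι)
    (f : ι → Matrix m n ℝ) (B : Matrix m n ℝ) : fip (∑ i ∈ t, f i) B = ∑ i ∈ t, fip (f i) B := by
  classical
  induction t using Finset.induction_on with
  | empty => simp [fip]
  | insert i t hi ih => rw [Finset.sum_insert hi, Finset.sum_insert hi, fip_add_left, ih]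

theorem fip_vecMulVec {m n : Type*} [Fintype m] [Fintype n] (u : m → ℝ) (w : n → ℝ)
    (B : Matrix m n ℝ) : fip (Matrix.vecMulVec u w) B = u ⬝ᵥ (B *ᵥ w) := by
  simp only [fip, Matrix.vecMulVec_apply, dotProduct, Matrix.mulVec, Finset.mul_sum]
  refine Finset.sum_congr rfl fun a _ => Finset.sum_congr rfl fun b _ => by ring

/-- The chain rule. -/
theorem fip_subgrad (A : Fin m → Tensor d) (y : Fin m → ℝ) (X : TTFactors d r) (i : Fin N)
    (H : Fin (d i) → Matrix (Fin (r i.castSucc)) (Fin (r i.succ)) ℝ) :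
    fip (subgrad A y X i) (leftUnfold H) =
      tinner (tensorSubgrad A y (ttTensor X)) (ttTensor (Function.update X i H)) := by
  rw [subgrad, fip_leftUnfold, tinner_tensorSubgrad]
  simp only [subgradSlice, fip_smul_left, fip_sum_left, fip_vecMulVec]
  rw [← Finset.mul_sum, Finset.sum_comm]
  congr 1
  refine Finset.sum_congr rfl fun k _ => ?_
  rw [← Finset.mul_sum]
  congr 1
  -- Grouping multi-indices by their i-th entry reproduces the slices of the subgradient.
  rw [tinner, ← Finset.sum_fiberwise Finset.univ fun s : (i : Fin N) → Fin (d i) => s i]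
  refine Finset.sum_congr rfl fun t _ => Finset.sum_congr rfl fun s hs => ?_
  rw [ttTensor_update, (Finset.mem_filter.1 hs).2]
  rfl

theorem leftUnfold_leftFold {e p q : ℕ} (M : Matrix (Fin e × Fin p) (Fin q) ℝ) :
    leftUnfold (leftFold M) = M := rfl

/-- The tensor subgradient need not have low rank, but it is tested only against tensor trains of
ranks r, for which the measurement bound is available. -/
theorem abs_fip_subgrad_le {s₀ : (i : Fin N) → Fin (d i)} {A : Fin m → Tensor d}
    {y : Fin m → ℝ} {X : TTFactors d r} (hX : LeftOrthogonal X) {c : ℝ} (hc : 0 ≤ c)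
    (hA : ∀ Z : TTFactors d r, (1 / m) * ∑ k, |tinner (A k) (ttTensor Z)| ≤ c * tnorm (ttTensor Z))
    {i : Fin N} {β : ℝ} (hβ : 0 ≤ β) (h : OpBound (sufMat s₀ X i.succ) β)
    (M : Matrix (Fin (d i) × Fin (r i.castSucc)) (Fin (r i.succ)) ℝ) :
    |fip (subgrad A y X i) M| ≤ c * (β * fnorm M) := by
  rw [← leftUnfold_leftFold M, fip_subgrad]
  refine (abs_tinner_tensorSubgrad_le _ _ _ _).trans ((hA _).trans ?_)
  exact mul_le_mul_of_nonneg_left (tnorm_ttTensor_update_le hX hβ h _) hc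

/-- Duality: pair the subgradient with itself and cancel one norm. -/
theorem frobSq_subgrad_le {s₀ : (i : Fin N) → Fin (d i)} {A : Fin m → Tensor d}
    {y : Fin m → ℝ} {X : TTFactors d r} (hX : LeftOrthogonal X) {c : ℝ} (hc : 0 ≤ c)
    (hA : ∀ Z : TTFactors d r, (1 / m) * ∑ k, |tinner (A k) (ttTensor Z)| ≤ c * tnorm (ttTensor Z))
    {i : Fin N} {β : ℝ} (hβ : 0 ≤ β) (h : OpBound (sufMat s₀ X i.succ) β) :
    frobSq (subgrad A y X i) ≤ (c * β) ^ 2 := by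
  have h1 := (le_abs_self _).trans (abs_fip_subgrad_le (y := y) hX hc hA hβ h (subgrad A y X i))
  have h0 := fnorm_nonneg (subgrad A y X i)
  rw [fip_self, ← fnorm_sq] at h1
  rw [← fnorm_sq]
  rcases h0.eq_or_lt with h2 | h2
  · rw [← h2]; simpa using sq_nonneg (c * β)
  · refine pow_le_pow_left₀ h0 ?_ 2
    refine le_of_mul_le_mul_right ?_ h2
    linarith

/-- (∑u)² is twice the sum over pairs plus ∑u², and Cauchy–Schwarz gives (∑u)² ≤ N∑u². -/
theorem sum_sum_Ioi_mul_le (u : Fin N → ℝ) :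
    ∑ i, ∑ j ∈ Finset.Ioi i, u i * u j ≤ (N - 1) / 2 * ∑ i, u i ^ 2 := by
  have h1 : (∑ i, u i) ^ 2 = 2 * ∑ i, ∑ j ∈ Finset.Ioi i, u i * u j + ∑ i, u i ^ 2 := by
    have e1 : ∀ i, ∑ j ∈ Finset.Ioi i, u i * u j = ∑ j, if i < j then u i * u j else 0 := by
      intro i
      rw [← Finset.sum_filter]
      refine Finset.sum_congr (by ext; simp) fun _ _ => rfl
    have e2 : ∑ i, ∑ j, (if i < j then u i * u j else 0) =
        ∑ i, ∑ j, if j < i then u i * u j else 0 := by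
      rw [Finset.sum_comm]
      refine Finset.sum_congr rfl fun i _ => Finset.sum_congr rfl fun j _ => ?_
      rw [mul_comm]
    have e3 : ∑ i, u i ^ 2 = ∑ i, ∑ j, if i = j then u i * u j else 0 := by
      simp [sq]
    rw [sq, Finset.sum_mul_sum, two_mul]
    simp only [e1]
    nth_rewrite 2 [e2]
    rw [e3, ← Finset.sum_add_distrib, ← Finset.sum_add_distrib]
    refine Finset.sum_congr rfl fun i _ => ?_
    rw [← Finset.sum_add_distrib, ← Finset.sum_add_distrib]
    refine Finset.sum_congr rfl fun j _ => ?_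
    rcases lt_trichotomy i j with h | h | h
    · simp [h, h.not_gt, h.ne]
    · simp [h]
    · simp [h, h.not_gt, h.ne']
  have h2 := sq_sum_le_card_mul_sum_sq (s := Finset.univ) (f := u)
  rw [Finset.card_univ, Fintype.card_fin, h1] at h2
  linarith

theorem fnorm_transpose_mul_self_le {m n : Type*} [Fintype m] [Fintype n] (D : Matrix m n ℝ) :
    fnorm (Dᵀ * D) ≤ frobSq D := by
  apply Real.sqrt_le_iff.2 ⟨frobSq_nonneg D, ?_⟩
  have h : OpBound Dᵀ (fnorm D) := (OpBound.of_frobSq_le (fnorm_sq _).ge).transpose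
  have := h.frobSq_mul_le D
  rwa [fnorm_sq, ← sq] at this

/-- The descent direction of the `i`-th factor: the Riemannian subgradient for all factors but the
last one, and the Euclidean subgradient for the last one. -/
noncomputable def stepDir (A : Fin m → Tensor d) (y : Fin m → ℝ) (X : TTFactors d r) (i : Fin N) :
    Matrix (Fin (d i) × Fin (r i.castSucc)) (Fin (r i.succ)) ℝ :=
  if i.val + 1 < N then tangentProj (leftUnfold (X i)) (subgrad A y X i) else subgrad A y X i

/-- Regularity condition: the correlation between descent directions and errors. -/
theorem sum_fip_stepDir_ge {s₀ : (i : Fin N) → Fin (d i)} (hN : 0 < N) {A : Fin m → Tensor d}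
    {s y : Fin m → ℝ} {X Y : TTFactors d r} (hX : LeftOrthogonal X) (hY : LeftOrthogonal Y)
    (hy : ∀ k, y k = tinner (A k) (ttTensor Y) + s k) {a c : ℝ} (hc : 0 ≤ c)
    (hA : ∀ Z : TTFactors d r, (1 / m) * ∑ k, |tinner (A k) (ttTensor Z)| ≤ c * tnorm (ttTensor Z))
    (hs : a * tnorm (ttTensor X - ttTensor Y) ≤
      (1 / m) * ∑ k, |tinner (A k) (ttTensor X - ttTensor Y) - s k| - (1 / m) * ∑ k, |s k|)
    (hσ : 0 < sigmaMax (ttTensor Y))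
    (hclose : tnorm (ttTensor X - ttTensor Y) ≤ sigmaMax (ttTensor Y) / 2) :
    a * tnorm (ttTensor X - ttTensor Y) - 3 * N / 4 * (c / sigmaMax (ttTensor Y)) *
      weightedDistSq (sigmaMax (ttTensor Y)) X Y ≤
        ∑ i, fip (stepDir A y X i) (leftUnfold (X i) - leftUnfold (Y i)) := by
  set σ := sigmaMax (ttTensor Y) with hσdef
  set D := weightedDistSq σ X Y with hD
  set G := tensorSubgrad A y (ttTensor X) with hG
  set Δ := fun i : Fin N => leftUnfold (X i) - leftUnfold (Y i) with hΔ
  set u := fun i : Fin N => wt σ i * fnorm (Δ i) with hu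
  have hu0 : ∀ i, 0 ≤ u i := fun i => mul_nonneg (wt_nonneg hσ.le i) (fnorm_nonneg _)
  have hDu : D = ∑ i, u i ^ 2 := by
    rw [hD, weightedDistSq]
    refine Finset.sum_congr rfl fun i _ => ?_
    rw [hu, mul_pow, fnorm_sq]
  have hGZ : ∀ Z : TTFactors d r, -(c * tnorm (ttTensor Z)) ≤ tinner G (ttTensor Z) := fun Z =>
    neg_le_of_abs_le ((abs_tinner_tensorSubgrad_le _ _ _ _).trans (hA Z))
  -- Replacing the i-th linearization by the i-th telescoping term costs the terms with two
  -- differences. The factor 1/σ appears because the difference at i enters unweighted, while u i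
  -- carries the weight σ.
  have hfirst : ∀ i, tinner G (ttTensor (hybrid X Y i)) - c / σ * ∑ j ∈ Finset.Ioi i, u i * u j ≤
      fip (subgrad A y X i) (Δ i) := by
    intro i
    have e : fip (subgrad A y X i) (Δ i) = tinner G (ttTensor (hybrid X Y i)) +
        ∑ j ∈ Finset.Ioi i, tinner G (ttTensor (hybrid₂ X Y i j)) := by
      rw [← tinner_sum_right, ← ttTensor_update_sub_hybrid, ← tinner_add_right,
        add_sub_cancel, hG, ← fip_subgrad]
      rfl
    have h2 : ∀ j ∈ Finset.Ioi i,
        -(c / σ * (u i * u j)) ≤ tinner G (ttTensor (hybrid₂ X Y i j)) := by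
      intro j hj
      have hij := Finset.mem_Ioi.1 hj
      refine le_trans ?_ (hGZ _)
      refine neg_le_neg ((mul_le_mul_of_nonneg_left (tnorm_hybrid₂_le (s₀ := s₀) hX hY hij)
        hc).trans (le_of_eq ?_))
      have hi : i.val + 1 < N := by
        have := j.2
        rw [Fin.lt_def] at hij
        omega
      simp only [hu, hΔ, ← hσdef]
      rw [show wt σ i = σ from if_pos hi]
      field_simp
    have h3 := Finset.sum_le_sum h2
    rw [Finset.sum_neg_distrib, ← Finset.mul_sum] at h3
    linarith
  -- Cost of the tangent projection: a suffix norm of at most 3σ/2, times the 1/2 of the quadratic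
  -- normal part, gives 3/4.
  have hsecond : ∀ i, fip (subgrad A y X i) (Δ i) - 3 / 4 * (c / σ) * u i ^ 2 ≤
      fip (stepDir A y X i) (Δ i) := by
    intro i
    rw [stepDir]
    split_ifs with hi
    · rw [hΔ, fip_tangentProj_sub (hX.isometry hi) (hY.isometry hi)]
      have hQ := OpBound.sufMat_wt (s₀ := s₀) hX hclose i
      rw [← hσdef] at hQ
      have h1 := (le_abs_self _).trans (abs_fip_subgrad_le (y := y) hX hc hA
        (wt_nonneg (by positivity) i) hQ
        ((1 / 2 : ℝ) • (leftUnfold (X i) * ((Δ i)ᵀ * Δ i))))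
      have h2 : fnorm ((1 / 2 : ℝ) • (leftUnfold (X i) * ((Δ i)ᵀ * Δ i))) ≤
          1 / 2 * frobSq (Δ i) := by
        rw [fnorm, frobSq_smul, frobSq_mul_of_isometry (hX.isometry hi),
          Real.sqrt_mul (sq_nonneg _), Real.sqrt_sq (by norm_num)]
        exact mul_le_mul_of_nonneg_left (fnorm_transpose_mul_self_le _) (by norm_num)
      have h3 : c * (wt (σ + σ / 2) i *
          fnorm ((1 / 2 : ℝ) • (leftUnfold (X i) * ((Δ i)ᵀ * Δ i)))) ≤
            3 / 4 * (c / σ) * u i ^ 2 := by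
        have e : 3 / 4 * (c / σ) * u i ^ 2 = c * ((σ + σ / 2) * (1 / 2 * frobSq (Δ i))) := by
          simp only [hu]
          rw [show wt σ i = σ from if_pos hi, mul_pow, fnorm_sq]
          field_simp
          ring
        rw [e, show wt (σ + σ / 2) i = σ + σ / 2 from if_pos hi]
        exact mul_le_mul_of_nonneg_left (mul_le_mul_of_nonneg_left h2 (by positivity)) hc
      linarith [h1.trans h3]
    · have : 0 ≤ 3 / 4 * (c / σ) * u i ^ 2 := by positivity
      linarith
  -- The telescoping terms add up to the full tensor error, to which sharpness applies. The error
  -- constants combine to (N-1)/2 + 3/4 ≤ 3N/4.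
  have hsum := Finset.sum_le_sum fun i (_ : i ∈ Finset.univ) =>
    (sub_le_sub_right (hfirst i) (3 / 4 * (c / σ) * u i ^ 2)).trans (hsecond i)
  rw [Finset.sum_sub_distrib, Finset.sum_sub_distrib, ← Finset.mul_sum, ← Finset.mul_sum, ← hDu,
    ← tinner_sum_right, ← ttTensor_sub_eq_sum] at hsum
  have hsharp := hs.trans (le_tinner_tensorSubgrad_sub A s y (ttTensor X) (ttTensor Y) hy)
  have hpair := mul_le_mul_of_nonneg_left (sum_sum_Ioi_mul_le u) (by positivity : 0 ≤ c / σ)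
  rw [← hDu] at hpair
  have hN' : (1 : ℝ) ≤ N := by exact_mod_cast hN
  have hD0 : 0 ≤ D := weightedDistSq_nonneg _ _ _
  have : 0 ≤ c / σ * D * (N - 1) := by
    have : (0 : ℝ) ≤ N - 1 := by linarith
    positivity
  refine le_trans ?_ hsum
  nlinarith

theorem LeftOrthogonal.frsubgmStep {A : Fin m → Tensor d} {y : Fin m → ℝ} {X : TTFactors d r}
    (hX : LeftOrthogonal X) (σ μ : ℝ) : LeftOrthogonal (frsubgmStep A y σ μ X) := by
  intro i
  rw [RobustTT.frsubgmStep, if_pos i.2, leftUnfold_leftFold]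
  exact (polarRetr_tangent (hX i) _ _).1

theorem LeftOrthogonal.frsubgm {A : Fin m → Tensor d} {y : Fin m → ℝ} {X : TTFactors d r}
    (hX : LeftOrthogonal X) (σ : ℝ) (μ : ℕ → ℝ) (t : ℕ) :
    LeftOrthogonal (frsubgm A y σ μ X t) := by
  induction t with
  | zero => exact hX
  | succ t ih => exact ih.frsubgmStep _ _

theorem sum_ite_inner (hN : 0 < N) (x z : ℝ) :
    ∑ i : Fin N, (if i.val + 1 < N then x else z) = (N - 1) * x + z := by
  obtain ⟨n, rfl⟩ := Nat.exists_eq_succ_of_ne_zero hN.ne'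
  rw [Fin.sum_univ_castSucc]
  simp

/-- One step of the factorized Riemannian subgradient method. -/
theorem weightedDistSq_frsubgmStep_le {s₀ : (i : Fin N) → Fin (d i)} (hN : 0 < N)
    {A : Fin m → Tensor d} {s y : Fin m → ℝ} {X Y : TTFactors d r} (hX : LeftOrthogonal X)
    (hY : LeftOrthogonal Y) (hy : ∀ k, y k = tinner (A k) (ttTensor Y) + s k) {a c μ : ℝ}
    (hc : 0 ≤ c) (hμ : 0 ≤ μ)
    (hA : ∀ Z : TTFactors d r, (1 / m) * ∑ k, |tinner (A k) (ttTensor Z)| ≤ c * tnorm (ttTensor Z))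
    (hs : a * tnorm (ttTensor X - ttTensor Y) ≤
      (1 / m) * ∑ k, |tinner (A k) (ttTensor X - ttTensor Y) - s k| - (1 / m) * ∑ k, |s k|)
    (hσ : 0 < sigmaMax (ttTensor Y))
    (hclose : tnorm (ttTensor X - ttTensor Y) ≤ sigmaMax (ttTensor Y) / 2) :
    weightedDistSq (sigmaMax (ttTensor Y)) (frsubgmStep A y (sigmaMax (ttTensor Y)) μ X) Y ≤
      weightedDistSq (sigmaMax (ttTensor Y)) X Y -
        2 * μ * (a * tnorm (ttTensor X - ttTensor Y) - 3 * N / 4 * (c / sigmaMax (ttTensor Y)) *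
          weightedDistSq (sigmaMax (ttTensor Y)) X Y) + μ ^ 2 * ((9 * N - 5) / 4 * c ^ 2) := by
  have hcross := sum_fip_stepDir_ge (s₀ := s₀) hN hX hY hy hc hA hs hσ hclose
  have hQ := OpBound.sufMat_wt (s₀ := s₀) hX hclose
  set σ := sigmaMax (ttTensor Y) with hσdef
  have hterm : ∀ i, wt σ i ^ 2 *
      frobSq (leftUnfold (frsubgmStep A y σ μ X i) - leftUnfold (Y i)) ≤
      wt σ i ^ 2 * frobSq (leftUnfold (X i) - leftUnfold (Y i)) -
        2 * μ * fip (stepDir A y X i) (leftUnfold (X i) - leftUnfold (Y i)) +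
        μ ^ 2 * (if i.val + 1 < N then 9 / 4 * c ^ 2 else c ^ 2) := by
    intro i
    have hU := frobSq_subgrad_le (y := y) hX hc hA (wt_nonneg (by positivity) i) (hQ i)
    by_cases hi : i.val + 1 < N
    · rw [show wt (σ + σ / 2) i = σ + σ / 2 from if_pos hi] at hU
      rw [frsubgmStep, if_pos hi, leftUnfold_leftFold, if_pos hi, stepDir, if_pos hi,
        show wt σ i = σ from if_pos hi]
      have h1 := (polarRetr_tangent (hX.isometry hi) (μ / σ ^ 2) (subgrad A y X i)).2 _
        (hY.isometry hi)
      refine (mul_le_mul_of_nonneg_left h1 (sq_nonneg σ)).trans ?_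
      have hP := (frobSq_tangentProj_le (hX.isometry hi) (subgrad A y X i)).trans hU
      set ξ := tangentProj (leftUnfold (X i)) (subgrad A y X i)
      rw [sub_right_comm, frobSq_sub, fip_smul_right, frobSq_smul, fip_comm]
      -- The weight σ² and the step μ/σ² cancel in the cross term, so all factors get the same
      -- coefficient 2μ.
      have e : σ ^ 2 * (frobSq (leftUnfold (X i) - leftUnfold (Y i)) -
          2 * (μ / σ ^ 2 * fip ξ (leftUnfold (X i) - leftUnfold (Y i))) +
          (μ / σ ^ 2) ^ 2 * frobSq ξ) =
          σ ^ 2 * frobSq (leftUnfold (X i) - leftUnfold (Y i)) -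
          2 * μ * fip ξ (leftUnfold (X i) - leftUnfold (Y i)) + μ ^ 2 * (frobSq ξ / σ ^ 2) := by
        field_simp
      rw [e]
      have h3 : frobSq ξ / σ ^ 2 ≤ 9 / 4 * c ^ 2 := by
        rw [div_le_iff₀ (by positivity)]
        refine hP.trans (le_of_eq ?_)
        ring
      linarith [mul_le_mul_of_nonneg_left h3 (sq_nonneg μ)]
    · rw [show wt (σ + σ / 2) i = 1 from if_neg hi, mul_one] at hU
      rw [frsubgmStep, if_neg hi, leftUnfold_leftFold, if_neg hi, stepDir, if_neg hi,
        show wt σ i = 1 from if_neg hi, sub_right_comm, frobSq_sub, fip_smul_right, frobSq_smul,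
        fip_comm]
      linarith [mul_le_mul_of_nonneg_left hU (sq_nonneg μ)]
  rw [weightedDistSq]
  refine (Finset.sum_le_sum fun i _ => hterm i).trans ?_
  rw [Finset.sum_add_distrib, Finset.sum_sub_distrib, ← Finset.mul_sum, ← Finset.mul_sum,
    sum_ite_inner hN, ← weightedDistSq]
  have := mul_le_mul_of_nonneg_left hcross (by positivity : 0 ≤ 2 * μ)
  -- N - 1 factors have suffix norm at most 3σ/2, hence 9/4 each; the last one contributes 1.
  have e : ((N : ℝ) - 1) * (9 / 4 * c ^ 2) + c ^ 2 = (9 * N - 5) / 4 * c ^ 2 := by ring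
  rw [e]
  linarith

end Subgradient

/-! ### Scalar recursion and constants. -/

section Convergence

variable {N m : ℕ} {d : Fin N → ℕ} {r : TTRanks N}

/-- Contraction of the squared distance by one step with a geometrically decaying step size. -/
theorem step_contraction {x X a c σ τ κ h M n e μ γ : ℝ} (hx : 0 ≤ x) (hxX : x ≤ X) (ha : 0 ≤ a)
    (hc : 0 < c) (hσ : 0 < σ) (hτ : 0 < τ) (hκ : κ = τ / σ) (hh : 0 < h) (hM : 0 < M)
    (hμ : μ = a / (h * M * c ^ 2 * κ) * X) (hxe : x ≤ 2 * h * κ * e)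
    (hsmall : 3 * n * h * c * x ≤ σ * a) (hγ : γ = a ^ 2 / (2 * h ^ 2 * M * c ^ 2 * κ ^ 2))
    (hγ1 : γ ≤ 1) :
    x ^ 2 - 2 * μ * (a * e - 3 * n / 4 * (c / τ) * x ^ 2) + μ ^ 2 * (M / 4 * c ^ 2) ≤
      (1 - γ / 2) * X ^ 2 := by
  have hκ0 : 0 < κ := by rw [hκ]; positivity
  have hX : 0 ≤ X := hx.trans hxX
  have hμ0 : 0 ≤ μ := by rw [hμ]; positivity
  have h1 : x / (2 * h * κ) ≤ e := by
    rw [div_le_iff₀ (by positivity)]; linarith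
  -- By smallness, the quadratic error uses at most half of the gain a·e guaranteed by `h1`.
  have h2 : 3 * n / 4 * (c / τ) * x ^ 2 ≤ a / (4 * h * κ) * x := by
    have : 3 * n / 4 * (c / τ) * x ≤ a / (4 * h * κ) := by
      rw [hκ]
      have e1 : 3 * n / 4 * (c / τ) * x = (3 * n * h * c * x) / (4 * h * τ) := by
        field_simp
      have e2 : a / (4 * h * (τ / σ)) = σ * a / (4 * h * τ) := by
        field_simp
      rw [e1, e2]
      exact div_le_div_of_nonneg_right hsmall (by positivity)
    calc 3 * n / 4 * (c / τ) * x ^ 2 = 3 * n / 4 * (c / τ) * x * x := by ring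
      _ ≤ _ := mul_le_mul_of_nonneg_right this hx
  have h3 : a / (4 * h * κ) * x ≤ a * e - 3 * n / 4 * (c / τ) * x ^ 2 := by
    have := mul_le_mul_of_nonneg_left h1 ha
    have e1 : a * (x / (2 * h * κ)) = 2 * (a / (4 * h * κ) * x) := by
      field_simp; ring
    linarith
  have h4 := mul_le_mul_of_nonneg_left h3 (by positivity : 0 ≤ 2 * μ)
  have h5 : 2 * μ * (a / (4 * h * κ) * x) = γ * X * x := by
    rw [hμ, hγ]; field_simp; ring
  have h6 : μ ^ 2 * (M / 4 * c ^ 2) = γ / 2 * X ^ 2 := by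
    rw [hμ, hγ]; field_simp; ring
  rw [h6]
  -- The step is tuned to the bound X and not to the true distance x. The remaining inequality x² -
  -- γXx + γX²/2 ≤ (1 - γ/2)X² is exactly this factorization.
  have h7 : 0 ≤ (X - x) * (x + (1 - γ) * X) :=
    mul_nonneg (by linarith) (add_nonneg hx (mul_nonneg (by linarith) hX))
  nlinarith

/-- Puts the initial tensor within the spectral gap, where the factor distance is controlled by the
tensor distance. -/
theorem initial_error_lt {n S σ τ a c : ℝ} (hn : 2 ≤ n) (hS : 3 ≤ S) (hσ : 0 < σ) (hστ : σ ≤ τ)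
    (ha : 0 ≤ a) (hc : 0 < c) (hac : a ≤ c) :
    σ ^ 4 * a ^ 2 / (144 * (2 * n ^ 2 - 2 * n + 1) * S ^ 2 * c ^ 2 * τ ^ 2) < σ ^ 2 := by
  have hτ : 0 < τ := hσ.trans_le hστ
  have hn2 : 5 ≤ 2 * n ^ 2 - 2 * n + 1 := by nlinarith
  have hS2 : 1 ≤ S ^ 2 := one_le_pow₀ (by linarith)
  rw [div_lt_iff₀ (by positivity)]
  have h1 : σ ^ 2 * a ^ 2 ≤ τ ^ 2 * c ^ 2 := by
    rw [← mul_pow, ← mul_pow]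
    exact pow_le_pow_left₀ (by positivity) (mul_le_mul hστ hac ha hτ.le) 2
  have h2 : 1 < 144 * (2 * n ^ 2 - 2 * n + 1) * S ^ 2 :=
    lt_of_lt_of_le (by linarith) (le_mul_of_one_le_right (by linarith) hS2)
  calc σ ^ 4 * a ^ 2 = σ ^ 2 * (σ ^ 2 * a ^ 2) := by ring
    _ ≤ σ ^ 2 * (τ ^ 2 * c ^ 2) := mul_le_mul_of_nonneg_left h1 (sq_nonneg σ)
    _ < σ ^ 2 * (τ ^ 2 * c ^ 2) * (144 * (2 * n ^ 2 - 2 * n + 1) * S ^ 2) :=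
      lt_mul_of_one_lt_right (by positivity) h2
    _ = _ := by ring

/-- The constant 144 is 9·2·8, so everything cancels except n²/(2n² - 2n + 1), which is at most one
because (n - 1)² ≥ 0. -/
theorem initial_distSq_le {n S σ τ a c h D : ℝ} (hn : 2 ≤ n) (hS : 3 ≤ S) (hσ : 0 < σ)
    (hτ : 0 < τ) (hc : 0 < c) (hh : h ^ 2 = 2 * S)
    (hD : D ≤ 8 * S * (τ / σ) ^ 2 *
      (σ ^ 4 * a ^ 2 / (144 * (2 * n ^ 2 - 2 * n + 1) * S ^ 2 * c ^ 2 * τ ^ 2))) :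
    (3 * n * h * c) ^ 2 * D ≤ (σ * a) ^ 2 := by
  have hn2 : 5 ≤ 2 * n ^ 2 - 2 * n + 1 := by nlinarith
  have hn3 : n ^ 2 ≤ 2 * n ^ 2 - 2 * n + 1 := by nlinarith [sq_nonneg (n - 1)]
  refine (mul_le_mul_of_nonneg_left hD (sq_nonneg _)).trans ?_
  generalize 2 * n ^ 2 - 2 * n + 1 = k at hn2 hn3
  have hk : 0 < k := by linarith
  have hS0 : 0 < S := by linarith
  have e : (3 * n * h * c) ^ 2 * (8 * S * (τ / σ) ^ 2 *
      (σ ^ 4 * a ^ 2 / (144 * k * S ^ 2 * c ^ 2 * τ ^ 2))) = n ^ 2 / k * (σ * a) ^ 2 := by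
    rw [mul_pow, mul_pow, hh]
    field_simp
    ring
  rw [e]
  exact mul_le_of_le_one_left (sq_nonneg _) ((div_le_one hk).2 hn3)

theorem contraction_factor_le_one {S M κ a c : ℝ} (hS : 3 ≤ S) (hM : 13 ≤ M) (hκ : 1 ≤ κ)
    (ha : 0 ≤ a) (hc : 0 < c) (hac : a ≤ c) :
    a ^ 2 / (2 * (2 * S) * M * c ^ 2 * κ ^ 2) ≤ 1 := by
  have h1 : a ^ 2 ≤ c ^ 2 := pow_le_pow_left₀ ha hac 2
  have h3 : 1 ≤ 2 * (2 * S) * M := by nlinarith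
  rw [div_le_one (by positivity)]
  calc a ^ 2 ≤ c ^ 2 := h1
    _ ≤ 2 * (2 * S) * M * c ^ 2 := le_mul_of_one_le_left (sq_nonneg c) h3
    _ ≤ 2 * (2 * S) * M * c ^ 2 * κ ^ 2 :=
      le_mul_of_one_le_right (by positivity) (one_le_pow₀ hκ)

/-- Small factor distance forces small tensor error, so the induction needs only the factor
distance: 4n ≤ 18Sn² leaves ample room. -/
theorem le_half_of_small {n h S x e a c σ : ℝ} (hn : 2 ≤ n) (hS : 3 ≤ S) (hh : h ^ 2 = 2 * S)
    (hh0 : 0 ≤ h) (hx : 0 ≤ x) (hσ : 0 < σ) (hc : 0 < c) (hac : a ≤ c)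
    (hsmall : 3 * n * h * c * x ≤ σ * a) (hex : e ^ 2 ≤ n * x ^ 2) : e ≤ σ / 2 := by
  have h1 : 3 * n * h * x ≤ σ := by
    refine le_of_mul_le_mul_right ?_ hc
    calc 3 * n * h * x * c = 3 * n * h * c * x := by ring
      _ ≤ σ * a := hsmall
      _ ≤ σ * c := mul_le_mul_of_nonneg_left hac hσ.le
  have h2 : (3 * n * h * x) ^ 2 ≤ σ ^ 2 := pow_le_pow_left₀ (by positivity) h1 2
  have h3 : (4 * n) * x ^ 2 ≤ (3 * n * h * x) ^ 2 := by
    rw [mul_pow, mul_pow, hh]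
    refine mul_le_mul_of_nonneg_right ?_ (sq_nonneg x)
    nlinarith
  refine le_of_sq_le_sq ?_ (by positivity)
  linarith

/-- Cauchy–Schwarz on the N telescoping terms. -/
theorem tnorm_sub_sq_le {s₀ : (i : Fin N) → Fin (d i)} {X Y : TTFactors d r}
    (hX : LeftOrthogonal X) (hY : LeftOrthogonal Y) :
    tnorm (ttTensor X - ttTensor Y) ^ 2 ≤
      N * weightedDistSq (sigmaMax (ttTensor Y)) X Y := by
  refine (pow_le_pow_left₀ (tnorm_nonneg _) (tnorm_sub_le_sum (s₀ := s₀) hX hY) 2).trans ?_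
  refine (sq_sum_le_card_mul_sum_sq).trans (le_of_eq ?_)
  rw [Finset.card_univ, Fintype.card_fin, weightedDistSq]
  simp only [mul_pow, fnorm_sq]

theorem sigmaMin_pos (hN : 2 ≤ N) {T : Tensor d}
    (hrank : ∀ i : InnerIdx N, (unfolding T i.1).rank = r i.1.succ) : 0 < sigmaMin r T := by
  have : Nonempty (InnerIdx N) := ⟨⟨⟨0, by omega⟩, by simp; omega⟩⟩
  obtain ⟨i, hi⟩ := exists_eq_ciInf_of_finite
    (f := fun i : InnerIdx N => sing (unfolding T i.1) (r i.1.succ))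
  rw [sigmaMin, ← hi, ← hrank i]
  exact sing_rank_pos _ (by rw [hrank i]; exact r.pos _)

theorem ne_zero_of_rank_unfolding (hN : 2 ≤ N) {T : Tensor d}
    (hrank : ∀ i : InnerIdx N, (unfolding T i.1).rank = r i.1.succ) : T ≠ 0 := by
  rintro rfl
  have h := hrank ⟨⟨0, by omega⟩, by simp; omega⟩
  have h2 : unfolding (0 : Tensor d) ⟨0, by omega⟩ = 0 := rfl
  rw [h2, Matrix.rank_zero] at h
  exact (r.pos _).ne h

theorem tnorm_pos {T : Tensor d} (hT : T ≠ 0) : 0 < tnorm T := by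
  rw [tnorm_eq_norm, norm_pos_iff]
  intro h
  exact hT (by simpa using congrArg WithLp.ofLp h)

end Convergence

end RobustTT

/-! ### Linear convergence by induction on the iterates. -/

theorem mainTheorem4 {N m : ℕ} (hN : 2 ≤ N) (hm : 0 < m) (d : Fin N → ℕ) (r : TTRanks N)
    -- the ground truth, given by left-orthogonal factors, with TT ranks `r`
    (Xs : TTFactors d r) (hXs : LeftOrthogonal Xs)
    (hrank : ∀ i : InnerIdx N, (unfolding (ttTensor Xs) i.1).rank = r i.1.succ)
    -- the measurements, the outliers and the corrupted data
    (A : Fin m → Tensor d) (s y : Fin m → ℝ)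
    (hy : ∀ k, y k = tinner (A k) (ttTensor Xs) + s k)
    (p : ℝ) (hp : p = outlierFraction s)
    (δ : ℝ) (hδ : δ ≤ (1 - 2 * p) * √(2 / Real.pi))
    (hRIP : L1L2RIP A ((N + 1) * r.max) δ)
    (hsharp : Sharpness r A (ttTensor Xs) s δ)
    (S : ℝ) (hS : S = N + 1 + ∑ i : InnerIdx N with 1 ≤ i.1.val, (r i.1.succ : ℝ))
    -- the initialization
    (X0 : TTFactors d r) (hX0 : LeftOrthogonal X0)
    (b : ℝ)
    (hb : b = sigmaMin r (ttTensor Xs) ^ 4 * ((1 - 2 * p) * √(2 / Real.pi) - δ) ^ 2 /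
      (144 * (2 * N ^ 2 - 2 * N + 1) * S ^ 2 * (√(2 / Real.pi) + δ) ^ 2 *
        sigmaMax (ttTensor Xs) ^ 2))
    (hinit : tnorm (ttTensor X0 - ttTensor Xs) ^ 2 ≤ b)
    -- the step sizes
    (lam q : ℝ)
    (hlam : lam = ((1 - 2 * p) * √(2 / Real.pi) - δ) /
      (√(2 * S) * (9 * N - 5) * (√(2 / Real.pi) + δ) ^ 2 * condNum r (ttTensor Xs)) *
        √(distSq X0 Xs))
    (hq : q = √(1 - ((1 - 2 * p) * √(2 / Real.pi) - δ) ^ 2 /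
      (8 * S * (9 * N - 5) * (√(2 / Real.pi) + δ) ^ 2 * condNum r (ttTensor Xs) ^ 2))) :
    ∀ t : ℕ,
      distSq (frsubgm A y (sigmaMax (ttTensor Xs)) (fun t => lam * q ^ t) X0 t) Xs ≤
        q ^ (2 * t) * distSq X0 Xs := by
  subst hp
  set g := √(2 / Real.pi) with hg
  set p := outlierFraction s with hp
  set a := (1 - 2 * p) * g - δ with ha
  set c := g + δ with hc
  set σ := sigmaMin r (ttTensor Xs) with hσdef
  set τ := sigmaMax (ttTensor Xs) with hτdef
  set κ := condNum r (ttTensor Xs) with hκdef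
  have hT0 := ne_zero_of_rank_unfolding hN hrank
  -- A base multi-index exists because the true tensor has positive ranks and so a nonzero entry.
  obtain ⟨s₀, -⟩ : ∃ s₀, ttTensor Xs s₀ ≠ 0 := Function.ne_iff.1 hT0
  have hσ : 0 < σ := sigmaMin_pos hN hrank
  have hστ : σ ≤ τ := sigmaMin_le_sigmaMax hN r _
  have hτ : 0 < τ := hσ.trans_le hστ
  have hκ : κ = τ / σ := rfl
  have hκ1 : 1 ≤ κ := by rw [hκ, one_le_div hσ]; exact hστ
  have hg0 : 0 < g := Real.sqrt_pos.2 (div_pos two_pos Real.pi_pos)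
  have hrank_le : ∀ i : InnerIdx N, r i.1.succ ≤ (N + 1) * r.max := fun i =>
    (Finset.le_sup (f := fun i : InnerIdx N => r i.1.succ) (Finset.mem_univ i)).trans
      (Nat.le_mul_of_pos_left _ (Nat.succ_pos N))
  -- The two sides of the RIP, compared at the nonzero true tensor, force δ ≥ 0.
  have hδ0 : 0 ≤ δ := by
    obtain ⟨h1, h2⟩ := hRIP r hrank_le Xs
    have h3 := le_of_mul_le_mul_right (h1.trans h2) (tnorm_pos hT0)
    linarith
  have hp0 : 0 ≤ p := by rw [hp, outlierFraction]; positivity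
  have ha0 : 0 ≤ a := sub_nonneg.2 hδ
  have hc0 : 0 < c := add_pos_of_pos_of_nonneg hg0 hδ0
  have hac : a ≤ c := by
    rw [ha, hc]
    have := mul_nonneg hp0 hg0.le
    linarith
  have hA : ∀ Z : TTFactors d r,
      (1 / m) * ∑ k, |tinner (A k) (ttTensor Z)| ≤ c * tnorm (ttTensor Z) :=
    fun Z => (hRIP r hrank_le Z).2
  have hlower : ∀ X : TTFactors d r, LeftOrthogonal X → tnorm (ttTensor X - ttTensor Xs) < σ →
      distSq X Xs ≤ 8 * S * κ ^ 2 * tnorm (ttTensor X - ttTensor Xs) ^ 2 := fun X hX hε =>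
    distSq_le_mul_tnorm_sq s₀ hN hX hXs (fun i hi => hrank ⟨i, hi⟩) hε hS
  have hsharp' : ∀ Z : TTFactors d r, a * tnorm (ttTensor Z - ttTensor Xs) ≤
      (1 / m) * ∑ k, |tinner (A k) (ttTensor Z - ttTensor Xs) - s k| - (1 / m) * ∑ k, |s k| :=
    hsharp
  clear_value κ τ σ c a p g
  have hN2 : (2 : ℝ) ≤ N := by exact_mod_cast hN
  have hS3 : 3 ≤ S := by
    have : (0 : ℝ) ≤ ∑ i : InnerIdx N with 1 ≤ i.1.val, (r i.1.succ : ℝ) :=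
      Finset.sum_nonneg fun _ _ => Nat.cast_nonneg _
    linarith
  set h := √(2 * S) with hh
  have hh2 : h ^ 2 = 2 * S := Real.sq_sqrt (by linarith)
  have hh0 : 0 < h := Real.sqrt_pos.2 (by linarith)
  set M : ℝ := 9 * N - 5 with hM
  have hM13 : 13 ≤ M := by linarith
  set γ := a ^ 2 / (2 * h ^ 2 * M * c ^ 2 * κ ^ 2) with hγ
  have hγ0 : 0 ≤ γ := by positivity
  have hγ1 : γ ≤ 1 := by
    rw [hγ, hh2]
    exact contraction_factor_le_one hS3 hM13 hκ1 ha0 hc0 hac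
  have hq2 : q ^ 2 = 1 - γ / 2 := by
    have e : a ^ 2 / (8 * S * M * c ^ 2 * κ ^ 2) = γ / 2 := by
      rw [hγ, hh2, div_div]; congr 1; ring
    rw [hq, e, Real.sq_sqrt (by linarith)]
  have hq0 : 0 ≤ q := by rw [hq]; exact Real.sqrt_nonneg _
  have hq1 : q ≤ 1 := by
    have : q ^ 2 ≤ 1 := by linarith
    exact (sq_le_one_iff₀ hq0).1 this
  clear_value γ M h
  set D₀ := distSq X0 Xs with hD₀
  have hD₀0 : 0 ≤ D₀ := distSq_nonneg _ _
  -- the initial distance of the factors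
  have hinit0 : tnorm (ttTensor X0 - ttTensor Xs) < σ := by
    refine lt_of_pow_lt_pow_left₀ 2 hσ.le (hinit.trans_lt ?_)
    rw [hb]
    exact initial_error_lt hN2 hS3 hσ hστ ha0 hc0 hac
  have hsmall0 : (3 * N * h * c) ^ 2 * D₀ ≤ (σ * a) ^ 2 := by
    refine initial_distSq_le hN2 hS3 hσ hτ hc0 hh2 ?_
    rw [← hb, ← hκ]
    exact (hlower X0 hX0 hinit0).trans (mul_le_mul_of_nonneg_left hinit (by positivity))
  intro t
  induction t with
  | zero => simp [frsubgm, hD₀]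
  | succ t ih =>
    set X := frsubgm A y τ (fun t => lam * q ^ t) X0 t with hXdef
    have hX : LeftOrthogonal X := hX0.frsubgm τ _ t
    -- This rotation, optimal for the current iterate, is merely admissible for the next one, which
    -- is enough for an upper bound.
    obtain ⟨R, hR⟩ := exists_distSq_eq X Xs
    have hY := hXs.rotate R
    have hsucc : frsubgm A y τ (fun t => lam * q ^ t) X0 (t + 1) =
        frsubgmStep A y τ (lam * q ^ t) X := rfl
    rw [hsucc]
    have hT : ttTensor (rotate R Xs) = ttTensor Xs := ttTensor_rotate R Xs
    refine (distSq_le _ Xs R).trans ?_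
    rw [← hτdef] at hR ⊢
    set Y := rotate R Xs with hYdef
    set x := √(distSq X Xs) with hx
    have hx2 : x ^ 2 = distSq X Xs := Real.sq_sqrt (distSq_nonneg _ _)
    have hx0 : 0 ≤ x := Real.sqrt_nonneg _
    have hxX : x ≤ q ^ t * √D₀ := by
      rw [hx]
      refine Real.sqrt_le_iff.2 ⟨by positivity, ?_⟩
      rw [mul_pow, Real.sq_sqrt hD₀0, ← pow_mul, mul_comm t]
      exact ih
    -- The smallness condition survives because the induction hypothesis and q ≤ 1 keep the distance
    -- below its initial value.
    have hsmall : 3 * N * h * c * x ≤ σ * a := by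
      refine le_of_sq_le_sq ?_ (by positivity)
      rw [mul_pow]
      refine (mul_le_mul_of_nonneg_left ?_ (sq_nonneg _)).trans hsmall0
      rw [hx2]
      exact ih.trans (mul_le_of_le_one_left hD₀0 (pow_le_one₀ hq0 hq1))
    set e := tnorm (ttTensor X - ttTensor Xs) with he
    have he0 : 0 ≤ e := tnorm_nonneg _
    have hex : e ^ 2 ≤ N * x ^ 2 := by
      have := tnorm_sub_sq_le (s₀ := s₀) hX hY
      rwa [hT, ← hτdef, ← hR, ← hx2] at this
    have heσ : e ≤ σ / 2 :=
      le_half_of_small hN2 hS3 hh2 hh0.le hx0 hσ hc0 hac hsmall hex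
    -- With h² = 2S, this is the square root of the bound D ≤ 8Sκ²e².
    have hxe : x ≤ 2 * h * κ * e := by
      refine le_of_sq_le_sq ?_ (mul_nonneg (mul_nonneg (mul_nonneg two_pos.le hh0.le)
        (zero_le_one.trans hκ1)) he0)
      rw [hx2, mul_pow, mul_pow, mul_pow, hh2]
      have hlt : e < σ := heσ.trans_lt (half_lt_self hσ)
      refine (hlower X hX hlt).trans (le_of_eq ?_)
      ring
    have hlam0 : 0 ≤ lam * q ^ t := by
      rw [hlam]
      exact mul_nonneg (mul_nonneg (div_nonneg ha0 (by positivity)) (Real.sqrt_nonneg _))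
        (pow_nonneg hq0 t)
    have hstep := weightedDistSq_frsubgmStep_le (s₀ := s₀) (s := s) (by omega) hX hY
      (by rwa [hT]) hc0.le hlam0 hA (a := a) (by rw [hT]; exact hsharp' X)
      (by rwa [hT, ← hτdef]) (by rw [hT, ← hτdef]; exact heσ.trans (div_le_div_of_nonneg_right hστ two_pos.le))
    rw [hT, ← hτdef, ← hR, ← hx2, ← he, ← hM] at hstep
    have hreal := step_contraction (μ := lam * q ^ t) (γ := γ) (M := M) (n := N) (e := e) hx0 hxX
      ha0 hc0 hσ hτ hκ hh0 (by linarith) (by rw [hlam]; ring) hxe hsmall hγ hγ1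
    refine hstep.trans (hreal.trans (le_of_eq ?_))
    rw [← hq2, mul_pow, Real.sq_sqrt hD₀0]
    ring
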